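/- Corollary 4.8 (Dirichlet–Neumann bracketing). Let $-\infty<a<b<\infty$ and let $J\neq\emptyset$ be an index set. For each $j\in J$ let $N_j\ge 2$, let $S^{(j)}_i(x)=r^{(j)}_i x+c^{(j)}_i$ ($1\le i\le N_j$, $r^{(j)}_i\in(0,1)$) be maps with $$a=S^{(j)}_1(a)<S^{(j)}_1(b)\le S^{(j)}_2(a)<S^{(j)}_2(b)\le\dots<S^{(j)}_{N_j}(b)=b,$$ and let $m^{(j)}_1,\dots,m^{(j)}_{N_j}>0$ be weights with $\sum_i m^{(j)}_i=1$. Assume that $\sup_j N_j<\infty$, $0<\inf_{j,i}m^{(j)}_i\le\sup_{j,i}m^{(j)}_i<1$ and $0<\inf_{j,i}r^{(j)}_i\le\sup_{j,i}r^{(j)}_i<1$. Let $V\in\mathbb N$. An environment $E$ assigns to each $v\in\{1,\dots,V\}$ an index $j^E_v\in J$ and types $\tau^E_{v,1},\dots,\tau^E_{v,N_{j_v^E}}\in\{1,\dots,V\}$; it is a neck if all $\tau^E_{v,i}$ are equal. A $V$-variable tree $I$ is given by a type $\tau^\emptyset$ of its ancestor $\emptyset$ and a sequence of environments $(E^n)_{n\ge1}$: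 an individual of generation $n-1$ and type $v$ is assigned the index $j=j_v^{E^n}$ and has $N_j$ children, the $i$-th of which has type $\tau^{E^n}_{v,i}$. Write $\theta_{\mathbf i}I$ for the subtree rooted at $\mathbf i=(i_1,\dots,i_n)\in I$ (again a $V$-variable tree), $|\mathbf i|=n$, $\mathbf i|_p=(i_1,\dots,i_p)$, and let $m_{\mathbf i}$, $r_{\mathbf i}$, $S_{\mathbf i}$ be the product of the weights, the product of the contraction ratios and the composition of the maps along $\mathbf i$. Let $\mu^{(I)}$ be the weak limit of the probability measures $\mu^{(I)}_n=\sum_{|\mathbf i|=n}m_{\mathbf i}\,\mu_0\circ S_{\mathbf i}^{-1}$, where $\mu_0$ is the uniform distribution on $[a,b]$. Let $\mathcal F=H^1([a,b])$, $\mathcal F_0=\{f\in\mathcal F: f(a)=f(b)=0\}$ and $\mathcal E(f,g)=\int_a^b f'g'\,dx$. The Neumann (resp. Dirichlet) eigenvalue counting function $N_N^{(I)}(x)$ (resp. $N_D^{(I)}(x)$) is the number of eigenvalues $\lambda\le x$, counted with multiplicity, of the form $\mathcal E$ with domain $\mathcal G=\mathcal F$ (resp. $\mathcal G=\mathcal F_0$)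 on $L_2(\mu^{(I)})$, that is, of the problem $f\in\mathcal G$, $\mathcal E(f,g)=\lambda\int fg\,d\mu^{(I)}$ for all $g\in\mathcal G$. Let $I$ be a $V$-variable tree with infinitely many neck levels, that is, $E^n$ is a neck for infinitely many $n\ge1$; let $n(1)<n(2)<\dots$ be these $n$, and $n(0)=0$. Put $\Lambda_0=\{\emptyset\}$ and, for $k\ge1$, $$\Lambda_k=\left\{\mathbf i\in I:\ \exists\, l\ge1:\ |\mathbf i|=n(l),\ m_{\mathbf i}r_{\mathbf i}\le e^{-k}<m_{\mathbf i|_{n(l-1)}}\,r_{\mathbf i|_{n(l-1)}}\right\}.$$ Then for all $k\ge0$ and all $x\ge0$ $$\sum_{\mathbf i\in\Lambda_k}N_D^{(\theta_{\mathbf i}I)}(r_{\mathbf i}m_{\mathbf i}x)\ \le\ N_D^{(I)}(x)\ \le\ N_N^{(I)}(x)\ \le\ \sum_{\mathbf i\in\Lambda_k}N_N^{(\theta_{\mathbf i}I)}(r_{\mathbf i}m_{\mathbf i}x).$$ -/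

import Mathlib

open MeasureTheory Set Filter Topology

/-- A family, indexed by `J`, of iterated function systems of orientation preserving affine
contractions `x ↦ r j i * x + c j i` of a compact interval `[a, b]`, `i = 0, …, N j - 1`, whose
images of `[a, b]` are ordered from left to right, do not overlap (they may touch), start at `a`
and end at `b`, together with a vector `m j` of positive weights with sum one. -/
structure IFSFamily (J : Type*) where
  a : ℝ
  b : ℝ
  a_lt_b : a < b
  N : J → ℕ
  two_le_N : ∀ j, 2 ≤ N j
  r : (j : J) → Fin (N j) → ℝ
  c : (j : J) → Fin (N j) → ℝ
  m : (j : J) → Fin (N j) → ℝ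
  r_pos : ∀ j i, 0 < r j i
  r_lt_one : ∀ j i, r j i < 1
  left_end : ∀ j (i : Fin (N j)), (i : ℕ) = 0 → r j i * a + c j i = a
  ordered : ∀ j (i i' : Fin (N j)), (i : ℕ) + 1 = i' →
    r j i * b + c j i ≤ r j i' * a + c j i'
  right_end : ∀ j (i : Fin (N j)), (i : ℕ) + 1 = N j → r j i * b + c j i = b
  m_pos : ∀ j i, 0 < m j i
  m_sum : ∀ j, ∑ i, m j i = 1

namespace IFSFamily

variable {J : Type*} (D : IFSFamily J)

/-- The interval `[a, b]`. -/
abbrev X : Type := Icc D.a D.b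

/-- The left end point of `[a, b]`. -/
def left : D.X := ⟨D.a, left_mem_Icc.2 D.a_lt_b.le⟩

/-- The right end point of `[a, b]`. -/
def right : D.X := ⟨D.b, right_mem_Icc.2 D.a_lt_b.le⟩

theorem lt_image (j : J) (i : Fin (D.N j)) :
    D.r j i * D.a + D.c j i < D.r j i * D.b + D.c j i := by
  have := mul_lt_mul_of_pos_left D.a_lt_b (D.r_pos j i)
  linarith

theorem le_image (j : J) : ∀ (n : ℕ) (i : Fin (D.N j)), (i : ℕ) = n →
    D.a ≤ D.r j i * D.a + D.c j i
  | 0, i, h => (D.left_end j i h).ge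
  | n + 1, i, h => by
    have hlt : n < D.N j := by have := i.2; omega
    have h1 := le_image j n ⟨n, hlt⟩ rfl
    have h2 := D.lt_image j ⟨n, hlt⟩
    have h3 := D.ordered j ⟨n, hlt⟩ i h.symm
    linarith

theorem image_le (j : J) : ∀ (n : ℕ) (i : Fin (D.N j)), (i : ℕ) + n + 1 = D.N j →
    D.r j i * D.b + D.c j i ≤ D.b
  | 0, i, h => (D.right_end j i h).le
  | n + 1, i, h => by
    have hlt : (i : ℕ) + 1 < D.N j := by omega
    have h1 := image_le j n ⟨(i : ℕ) + 1, hlt⟩ (by simp only; omega)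
    have h2 := D.lt_image j ⟨(i : ℕ) + 1, hlt⟩
    have h3 := D.ordered j i ⟨(i : ℕ) + 1, hlt⟩ rfl
    linarith

/-- The contraction `S_i^{(j)} : [a, b] → [a, b]`. -/
def S (j : J) (i : Fin (D.N j)) (x : D.X) : D.X :=
  ⟨D.r j i * x + D.c j i, by
    have h1 := D.le_image j i i rfl
    have h2 := D.image_le j (D.N j - 1 - i) i (by have := i.2; omega)
    have h3 := mul_le_mul_of_nonneg_left x.2.1 (D.r_pos j i).le
    have h4 := mul_le_mul_of_nonneg_left x.2.2 (D.r_pos j i).le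
    exact ⟨by linarith, by linarith⟩⟩

theorem measurable_S (j : J) (i : Fin (D.N j)) : Measurable (D.S j i) := by
  unfold S
  fun_prop

/-- The uniform distribution on `[a, b]`. -/
noncomputable def uniform : Measure D.X :=
  ENNReal.ofReal (D.b - D.a)⁻¹ • (volume : Measure ℝ).comap Subtype.val

instance : IsProbabilityMeasure D.uniform := by
  constructor
  have h : (0 : ℝ) < D.b - D.a := sub_pos.2 D.a_lt_b
  have h1 : ((volume : Measure ℝ).comap (Subtype.val : D.X → ℝ)) univ =
      ENNReal.ofReal (D.b - D.a) := by
    rw [comap_subtype_coe_apply measurableSet_Icc, image_univ, Subtype.range_coe, Real.volume_Icc]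
  rw [uniform, Measure.smul_apply, h1, smul_eq_mul, ← ENNReal.ofReal_mul (inv_nonneg.2 h.le),
    inv_mul_cancel₀ h.ne', ENNReal.ofReal_one]

end IFSFamily

/-- An environment assigns to every type `v` an index in `J` and a type to each of the
`N j` positions belonging to that index. -/
structure VEnvironment {J : Type*} (D : IFSFamily J) (V : ℕ) where
  index : Fin V → J
  type : (v : Fin V) → Fin (D.N (index v)) → Fin V

/-- A neck: all assigned types are equal. -/
def VEnvironment.IsNeck {J : Type*} {D : IFSFamily J} {V : ℕ} (E : VEnvironment D V) : Prop :=
  ∃ t, ∀ v i, E.type v i = t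

/-- A `V`-variable tree, given by the type of its ancestor and a sequence of environments;
`env k` is the environment leading from generation `k` to generation `k + 1`. -/
structure VTree {J : Type*} (D : IFSFamily J) (V : ℕ) where
  rootType : Fin V
  env : ℕ → VEnvironment D V

namespace VTree

variable {J : Type*} {D : IFSFamily J} {V : ℕ}

/-- The index of the ancestor. -/
def index (T : VTree D V) : J := (T.env 0).index T.rootType

/-- The subtree rooted at the `i`-th child of the ancestor. -/
def child (T : VTree D V) (i : Fin (D.N T.index)) : VTree D V where
  rootType := (T.env 0).type T.rootType i
  env k := T.env (k + 1)

/-- The individuals of the tree: the ancestor, and the finite words `(i, w)` where `i` is a child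
of the ancestor and `w` an individual of the subtree rooted at `i`. -/
inductive Node : VTree D V → Type _
  | root {T : VTree D V} : Node T
  | cons {T : VTree D V} (i : Fin (D.N T.index)) (w : Node (T.child i)) : Node T

namespace Node

/-- The generation (the length of the word). -/
def length : {T : VTree D V} → Node T → ℕ
  | _, root => 0
  | _, cons _ w => w.length + 1

/-- The subtree `θ_w T` rooted at `w`. -/
def subtree : {T : VTree D V} → Node T → VTree D V
  | T, root => T
  | _, cons _ w => w.subtree

/-- The product of the weights along the word. -/
def mass : {T : VTree D V} → Node T → ℝ
  | _, root => 1
  | T, cons i w => D.m T.index i * w.mass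

/-- The product of the contraction ratios along the word. -/
def ratio : {T : VTree D V} → Node T → ℝ
  | _, root => 1
  | T, cons i w => D.r T.index i * w.ratio

/-- The composition of the contractions along the word. -/
def map : {T : VTree D V} → Node T → D.X → D.X
  | _, root => id
  | T, cons i w => D.S T.index i ∘ w.map

/-- The first `n` letters of the word (the word itself if it is shorter). -/
def take : {T : VTree D V} → Node T → ℕ → Node T
  | _, root, _ => root
  | _, cons _ _, 0 => root
  | _, cons i w, n + 1 => cons i (w.take n)

theorem measurable_map : {T : VTree D V} → (w : Node T) → Measurable w.map
  | _, root => measurable_id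
  | T, cons i w => (D.measurable_S T.index i).comp w.measurable_map

theorem mass_pos : {T : VTree D V} → (w : Node T) → 0 < w.mass
  | _, root => one_pos
  | T, cons i w => mul_pos (D.m_pos T.index i) w.mass_pos

end Node

/-- The individuals of generation `n`. -/
def generation : ℕ → (T : VTree D V) → Finset (Node T)
  | 0, _ => {Node.root}
  | n + 1, T => (Finset.univ.sigma fun i => generation n (T.child i)).map
      ⟨fun p => Node.cons p.1 p.2, by
        rintro ⟨i, w⟩ ⟨i', w'⟩ h
        simp only [Node.cons.injEq] at h
        obtain ⟨rfl, h⟩ := h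
        rw [eq_of_heq h]⟩

theorem mem_generation : {T : VTree D V} → (n : ℕ) → (w : Node T) →
    (w ∈ generation n T ↔ w.length = n)
  | _, 0, .root => by simp [generation, Node.length]
  | _, 0, .cons i w => by simp [generation, Node.length]
  | _, n + 1, .root => by simp [generation, Node.length]
  | _, n + 1, .cons i w => by
    have ih := mem_generation n w
    simp only [generation, Finset.mem_map, Finset.mem_sigma, Finset.mem_univ, true_and,
      Node.length, Nat.add_right_cancel_iff, ← ih]
    constructor
    · rintro ⟨⟨i', w'⟩, h, h'⟩
      change Node.cons i' w' = Node.cons i w at h'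
      simp only [Node.cons.injEq] at h'
      obtain ⟨rfl, h'⟩ := h'
      rw [← eq_of_heq h']
      exact h
    · intro h
      exact ⟨⟨i, w⟩, h, rfl⟩

theorem sum_mass : (n : ℕ) → (T : VTree D V) → ∑ w ∈ generation n T, w.mass = 1
  | 0, T => by simp [generation, Node.mass]
  | n + 1, T => by
    rw [generation, Finset.sum_map, Finset.sum_sigma]
    change ∑ i, ∑ w ∈ generation n (T.child i), D.m T.index i * w.mass = 1
    simp only [← Finset.mul_sum, sum_mass n, mul_one, D.m_sum]

/-- The measure `μ_n`: the sum over the individuals `w` of generation `n` of `m_w` times the image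
of the uniform distribution under `S_w`. -/
noncomputable def approxMeasure (T : VTree D V) (n : ℕ) : ProbabilityMeasure D.X :=
  ⟨∑ w ∈ generation n T, ENNReal.ofReal w.mass • D.uniform.map w.map, by
    constructor
    have h : ∀ w : Node T, (D.uniform.map w.map) univ = 1 := fun w => by
      rw [Measure.map_apply w.measurable_map MeasurableSet.univ, preimage_univ, measure_univ]
    simp only [Measure.coe_finsetSum, Finset.sum_apply, Measure.smul_apply, h, smul_eq_mul,
      mul_one]
    rw [← ENNReal.ofReal_sum_of_nonneg fun w _ => w.mass_pos.le, sum_mass, ENNReal.ofReal_one]⟩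

/-- The `V`-variable Cantor measure: the weak limit of the measures `μ_n`. -/
noncomputable def cantorMeasure (T : VTree D V) : ProbabilityMeasure D.X :=
  @limUnder _ _ _ ⟨T.approxMeasure 0⟩ atTop T.approxMeasure

/-- The level `n ≥ 1` is a neck of the tree: the environment leading to generation `n` is one. -/
def IsNeckLevel (T : VTree D V) (n : ℕ) : Prop := ∃ l, n = l + 1 ∧ (T.env l).IsNeck

/-- `neckLevel l` is the `l`-th neck level, with `neckLevel 0 = 0`. -/
noncomputable def neckLevel (T : VTree D V) : ℕ → ℕ
  | 0 => 0
  | l + 1 => Nat.nth T.IsNeckLevel l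

/-- The sets `Λ_k` of individuals. -/
def cutSet (T : VTree D V) : ℕ → Set (Node T)
  | 0 => {Node.root}
  | k + 1 => {w | ∃ l : ℕ, 1 ≤ l ∧ w.length = T.neckLevel l ∧
      w.mass * w.ratio ≤ Real.exp (-((k + 1 : ℕ) : ℝ)) ∧
      Real.exp (-((k + 1 : ℕ) : ℝ)) <
        (w.take (T.neckLevel (l - 1))).mass * (w.take (T.neckLevel (l - 1))).ratio}

end VTree

namespace IFSFamily

variable {J : Type*} (D : IFSFamily J)

/-- `u` is an `L²` weak derivative of `f : [a, b] → ℝ`. -/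
def IsWeakDeriv (f : D.X → ℝ) (u : ℝ → ℝ) : Prop :=
  MemLp u 2 (volume.restrict (Icc D.a D.b)) ∧
    ∀ x : D.X, f x = f D.left + ∫ t in D.a..(x : ℝ), u t

variable {D}

theorem IsWeakDeriv.intervalIntegrable {f : D.X → ℝ} {u : ℝ → ℝ} (h : D.IsWeakDeriv f u)
    (x : D.X) : IntervalIntegrable u volume D.a x := by
  have h1 : IntegrableOn u (Icc D.a D.b) := h.1.integrable (by norm_num)
  rw [intervalIntegrable_iff_integrableOn_Icc_of_le x.2.1]
  exact h1.mono_set (Icc_subset_Icc_right x.2.2)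

theorem IsWeakDeriv.add {f g : D.X → ℝ} {u v : ℝ → ℝ} (hf : D.IsWeakDeriv f u)
    (hg : D.IsWeakDeriv g v) : D.IsWeakDeriv (f + g) (u + v) := by
  refine ⟨hf.1.add hg.1, fun x => ?_⟩
  simp only [Pi.add_apply]
  rw [intervalIntegral.integral_add (hf.intervalIntegrable x) (hg.intervalIntegrable x),
    hf.2 x, hg.2 x]
  ring

theorem IsWeakDeriv.smul {f : D.X → ℝ} {u : ℝ → ℝ} (s : ℝ) (hf : D.IsWeakDeriv f u) :
    D.IsWeakDeriv (s • f) (s • u) := by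
  refine ⟨hf.1.const_smul s, fun x => ?_⟩
  simp only [Pi.smul_apply, smul_eq_mul]
  rw [intervalIntegral.integral_const_mul, hf.2 x]
  ring

theorem isWeakDeriv_zero : D.IsWeakDeriv 0 0 := by
  refine ⟨MemLp.zero, fun x => ?_⟩
  simp

theorem IsWeakDeriv.continuous {f : D.X → ℝ} {u : ℝ → ℝ} (h : D.IsWeakDeriv f u) :
    Continuous f := by
  have h1 : IntegrableOn u (uIcc D.a D.b) := by
    rw [uIcc_of_le D.a_lt_b.le]
    exact h.1.integrable (by norm_num)
  have h2 := intervalIntegral.continuousOn_primitive_interval h1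
  rw [uIcc_of_le D.a_lt_b.le, continuousOn_iff_continuous_domRestrict] at h2
  have h3 : f = fun x => f D.left + (Icc D.a D.b).domRestrict (fun x => ∫ t in D.a..x, u t) x :=
    funext fun x => h.2 x
  rw [h3]
  exact continuous_const.add h2

theorem IsWeakDeriv.integrable_mul {f g : D.X → ℝ} {u v : ℝ → ℝ} (hf : D.IsWeakDeriv f u)
    (hg : D.IsWeakDeriv g v) (μ : ProbabilityMeasure D.X) :
    Integrable (fun x => f x * g x) (μ : Measure D.X) :=
  (hf.continuous.mul hg.continuous).integrable_of_hasCompactSupport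
    (HasCompactSupport.of_compactSpace _)

theorem IsWeakDeriv.intervalIntegrable_mul {f g : D.X → ℝ} {u v : ℝ → ℝ}
    (hf : D.IsWeakDeriv f u) (hg : D.IsWeakDeriv g v) :
    IntervalIntegrable (fun t => u t * v t) volume D.a D.b := by
  rw [intervalIntegrable_iff_integrableOn_Icc_of_le D.a_lt_b.le]
  exact hf.1.integrable_mul hg.1

variable (D)

/-- The Sobolev space `H¹` of the interval `[a, b]`, the domain of the Neumann form. -/
def sobolev : Submodule ℝ (D.X → ℝ) where
  carrier := {f | ∃ u, D.IsWeakDeriv f u}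
  add_mem' := fun ⟨u, hu⟩ ⟨v, hv⟩ => ⟨u + v, hu.add hv⟩
  zero_mem' := ⟨0, isWeakDeriv_zero⟩
  smul_mem' := fun s _ ⟨u, hu⟩ => ⟨s • u, hu.smul s⟩

/-- The functions in `H¹` that vanish at both end points, the domain of the Dirichlet form. -/
def sobolevZero : Submodule ℝ (D.X → ℝ) where
  carrier := {f | f ∈ D.sobolev ∧ f D.left = 0 ∧ f D.right = 0}
  add_mem' := fun ⟨hf, hf1, hf2⟩ ⟨hg, hg1, hg2⟩ =>
    ⟨add_mem hf hg, by simp [hf1, hg1], by simp [hf2, hg2]⟩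
  zero_mem' := ⟨zero_mem _, rfl, rfl⟩
  smul_mem' := fun s _ ⟨hf, hf1, hf2⟩ =>
    ⟨Submodule.smul_mem _ s hf, by simp [hf1], by simp [hf2]⟩

/-- The eigenspace, for the number `l`, of the form `𝓔(f, g) = ∫ₐᵇ f' g'` with domain `F` on
`L²(μ)`: all `f ∈ F` with `𝓔(f, g) = l * ∫ f g dμ` for all `g ∈ F`. -/
def eigenspace (F : Submodule ℝ (D.X → ℝ)) (μ : ProbabilityMeasure D.X) (l : ℝ) :
    Submodule ℝ (D.X → ℝ) where
  carrier := {f | f ∈ F ∧ ∃ u, D.IsWeakDeriv f u ∧ ∀ g ∈ F, ∀ v, D.IsWeakDeriv g v →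
    ∫ t in D.a..D.b, u t * v t = l * ∫ x, f x * g x ∂(μ : Measure D.X)}
  add_mem' := by
    rintro f₁ f₂ ⟨hf₁, u₁, hu₁, h₁⟩ ⟨hf₂, u₂, hu₂, h₂⟩
    refine ⟨add_mem hf₁ hf₂, u₁ + u₂, hu₁.add hu₂, fun g hg v hv => ?_⟩
    simp only [Pi.add_apply, add_mul]
    rw [intervalIntegral.integral_add (hu₁.intervalIntegrable_mul hv)
      (hu₂.intervalIntegrable_mul hv), integral_add (hu₁.integrable_mul hv μ)
      (hu₂.integrable_mul hv μ), h₁ g hg v hv, h₂ g hg v hv, mul_add]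
  zero_mem' := ⟨zero_mem _, 0, isWeakDeriv_zero, fun g _ v _ => by simp⟩
  smul_mem' := by
    rintro s f ⟨hf, u, hu, h⟩
    refine ⟨Submodule.smul_mem _ s hf, s • u, hu.smul s, fun g hg v hv => ?_⟩
    simp only [Pi.smul_apply, smul_eq_mul, mul_assoc]
    rw [intervalIntegral.integral_const_mul, integral_const_mul, h g hg v hv]
    ring

/-- The eigenvalue counting function: the number of eigenvalues `l ≤ x`, each counted with its
multiplicity (numbers `l` that are not eigenvalues contribute `0`). -/
noncomputable def eigenvalueCount (F : Submodule ℝ (D.X → ℝ)) (μ : ProbabilityMeasure D.X)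
    (x : ℝ) : ℕ∞ :=
  ∑' l : Iic x, Cardinal.toENat (Module.rank ℝ (D.eigenspace F μ l))

end IFSFamily

namespace VTree

variable {J : Type*} {D : IFSFamily J} {V : ℕ}

/-- The Dirichlet eigenvalue counting function of the Cantor measure of the tree. -/
noncomputable def dirichletCount (T : VTree D V) (x : ℝ) : ℕ∞ :=
  D.eigenvalueCount D.sobolevZero T.cantorMeasure x

/-- The Neumann eigenvalue counting function of the Cantor measure of the tree. -/
noncomputable def neumannCount (T : VTree D V) (x : ℝ) : ℕ∞ :=
  D.eigenvalueCount D.sobolev T.cantorMeasure x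

end VTree

open scoped Cardinal
open InnerProductSpace
-- Eigenvectors for distinct eigenvalues are orthogonal in L²(μ), so the counting function at x is
-- the dimension of the span of the eigenspaces for eigenvalues at most x. On this span the Rayleigh
-- quotient is at most x; a nonzero vector orthogonal to it in L²(μ) has a quotient larger than x
-- (`IsSpectral`). The latter holds because H¹ embeds compactly into L²(μ), so the spectral theorem
-- applies to the Hilbert space with inner product 𝓔 + ⟨·,·⟩_μ.
--
-- Together these give a variational comparison, `toENat_rank_le_sum_spectralSubspace`: a space M,
-- mapped linearly into form domains N i, has dimension at most the sum of their counts as soon as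
-- only 0 in M has all its images zero or of quotient beyond the thresholds.
--
-- The measure splits over one generation, μ = ∑ m_i (S_i)_* μ_i with μ_i the measure of the i-th
-- subtree (`integral_cantorMeasure`), and S_i multiplies energies by r_i⁻¹. Hence the threshold x
-- on the interval becomes r_i m_i x on the i-th copy. Gluing Dirichlet functions along the images,
-- with zero on the gaps, yields the lower bound for one generation; restricting functions to the
-- images, where no matching condition is imposed and the energy of the gaps is dropped, yields the
-- upper bound. The middle inequality comes from the inclusion of the Dirichlet domain in the
-- Neumann domain.
--
-- Finally, Λ_k is a cut of the tree: it meets every sufficiently long line of descent exactly once.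
-- Induction on the depth of the cut, with one generation at a time, gives the theorem
-- (`tsum_le_of_isCut`, `le_tsum_of_isCut`). The necks enter only through the infinitude of their
-- levels.
-- Dimensions as sums in ℕ∞
theorem ENat.summable' {ι : Type*} (f : ι → ℕ∞) : Summable f :=
  ⟨_, hasSum_of_isLUB _ isLUB_iSup⟩

theorem ENat.sum_le_tsum {ι : Type*} (f : ι → ℕ∞) (s : Finset ι) : ∑ i ∈ s, f i ≤ ∑' i, f i :=
  (ENat.summable' f).sum_le_tsum s fun _ _ => zero_le

theorem Cardinal.mk_setOf_fst_mem {ι : Type} {β : ι → Type} (s : Finset ι) :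
    #{p : Σ i, β i | p.1 ∈ s} = ∑ i ∈ s, #(β i) := by
  classical
  induction s using Finset.induction_on with
  | empty => simp
  | insert a s ha ih =>
    have h : {p : Σ i, β i | p.1 ∈ insert a s} = {p | p.1 = a} ∪ {p | p.1 ∈ s} := by
      ext p; simp
    rw [h, Cardinal.mk_union_of_disjoint, ih, Finset.sum_insert ha]
    · congr 1
      exact Cardinal.mk_congr (Equiv.sigmaSubtype a)
    · rw [Set.disjoint_left]
      rintro p rfl hp
      exact ha hp

theorem Cardinal.finsetSum_le_sum {ι : Type} (f : ι → Cardinal.{0}) (s : Finset ι) :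
    ∑ i ∈ s, f i ≤ Cardinal.sum f := by
  have h := Cardinal.mk_setOf_fst_mem (β := fun i => (f i).out) s
  simp only [Cardinal.mk_out] at h
  rw [← h]
  exact Cardinal.mk_set_le _

/-- If the series has the finite value n, then any finite subset of the disjoint union meets
finitely many summands. Counting it fibre by fibre bounds its size by a partial sum, hence by n. -/
theorem Cardinal.toENat_sum_eq_tsum {ι : Type} (f : ι → Cardinal.{0}) :
    toENat (Cardinal.sum f) = ∑' i, toENat (f i) := by
  classical
  apply le_antisymm
  · induction h : ∑' i, toENat (f i) using ENat.recTopCoe with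
    | top => exact le_top
    | coe n =>
      have h' : Cardinal.sum f = #(Σ i, (f i).out) := by simp [Cardinal.mk_sigma]
      rw [Cardinal.toENat_le_natCast, h']
      refine Cardinal.card_le_of fun s => ?_
      have h1 := (ENat.sum_le_tsum (fun i => toENat (f i)) (s.image Sigma.fst)).trans_eq h
      rw [← map_sum, Cardinal.toENat_le_natCast] at h1
      rw [← Nat.cast_le (α := Cardinal.{0})]
      refine le_trans ?_ h1
      rw [Finset.card_eq_sum_card_fiberwise
        (t := s.image Sigma.fst) fun x hx => Finset.mem_image_of_mem Sigma.fst hx,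
        Nat.cast_sum]
      refine Finset.sum_le_sum fun i _ => ?_
      rw [← Cardinal.mk_out (f i), ← Cardinal.mk_coe_finset]
      refine Cardinal.mk_le_of_injective
        (f := fun p => cast (by rw [(Finset.mem_filter.1 p.2).2]) p.1.2) ?_
      rintro ⟨⟨j, x⟩, hx⟩ ⟨⟨k, y⟩, hy⟩ hxy
      obtain rfl : j = i := (Finset.mem_filter.1 hx).2
      obtain rfl : k = j := (Finset.mem_filter.1 hy).2
      simpa using hxy
  · refine (ENat.summable' _).tsum_le_of_sum_le fun s => ?_
    rw [← map_sum]
    exact OrderHomClass.mono _ (Cardinal.finsetSum_le_sum f s)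

theorem toENat_rank_iSup {ι M : Type} [AddCommGroup M] [Module ℝ M] (p : ι → Submodule ℝ M)
    (h : iSupIndep p) :
    Cardinal.toENat (Module.rank ℝ (⨆ i, p i : Submodule ℝ M)) =
      ∑' i, Cardinal.toENat (Module.rank ℝ (p i)) := by
  classical
  rw [← Cardinal.toENat_sum_eq_tsum, ← rank_directSum, Submodule.iSup_eq_range_dfinsupp_lsum]
  exact congrArg _ (LinearEquiv.ofInjective _ h.dfinsupp_lsum_injective).rank_eq.symm

/-- A finite family of finite dimensional test spaces that separates the points of `M` bounds the
dimension of `M`. -/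
theorem toENat_rank_le_sum {ι M : Type} [Fintype ι] [AddCommGroup M] [Module ℝ M]
    {N : ι → Type} [∀ i, AddCommGroup (N i)] [∀ i, Module ℝ (N i)]
    (b : (i : ι) → M →ₗ[ℝ] Module.Dual ℝ (N i)) (h : ∀ f, (∀ i, b i f = 0) → f = 0) :
    Cardinal.toENat (Module.rank ℝ M) ≤ ∑ i, Cardinal.toENat (Module.rank ℝ (N i)) := by
  -- A finite dimensional space and its dual have the same dimension; if some `N i` is infinite
  -- dimensional, the right side is ⊤.
  by_cases hfin : ∀ i, FiniteDimensional ℝ (N i)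
  · have h1 : Function.Injective (LinearMap.pi b) := by
      rw [← LinearMap.ker_eq_bot, LinearMap.ker_eq_bot']
      exact fun f hf => h f fun i => congrFun hf i
    have h2 := LinearMap.rank_le_of_injective _ h1
    rw [rank_pi] at h2
    refine (OrderHomClass.mono Cardinal.toENat h2).trans_eq ?_
    rw [Cardinal.toENat_sum_eq_tsum, tsum_fintype]
    refine Finset.sum_congr rfl fun i _ => ?_
    rw [← Module.finrank_eq_rank, ← Module.finrank_eq_rank, Subspace.dual_finrank_eq]
  · push Not at hfin
    obtain ⟨i, hi⟩ := hfin
    have : Cardinal.toENat (Module.rank ℝ (N i)) = ⊤ := by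
      rw [Cardinal.toENat_eq_top]
      by_contra h
      exact hi (Module.rank_lt_aleph0_iff.1 (not_le.1 h))
    refine le_top.trans ?_
    rw [← this]
    exact Finset.single_le_sum (f := fun i => Cardinal.toENat (Module.rank ℝ (N i)))
      (fun _ _ => zero_le) (Finset.mem_univ i)

/-- The mixed terms vanish, so a finite sum of vectors only sees the diagonal terms of `Q`. This
transfers a bound on the quadratic form from single eigenvectors to their span. -/
theorem nonneg_of_mem_iSup {ι M : Type*} [AddCommGroup M] [Module ℝ M]
    (Q : M →ₗ[ℝ] M →ₗ[ℝ] ℝ) (p : ι → Submodule ℝ M) (hpos : ∀ i, ∀ x ∈ p i, 0 ≤ Q x x)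
    (horth : ∀ i j, i ≠ j → ∀ x ∈ p i, ∀ y ∈ p j, Q x y = 0) {x : M} (hx : x ∈ ⨆ i, p i) :
    0 ≤ Q x x := by
  obtain ⟨f, hf, rfl⟩ := (Submodule.mem_iSup_iff_exists_finsupp _ _).1 hx
  simp only [Finsupp.sum, map_sum, LinearMap.coe_sum, Finset.sum_apply]
  refine Finset.sum_nonneg fun i hi => ?_
  rw [Finset.sum_eq_single i]
  · exact hpos i _ (hf i)
  · exact fun j _ hj => horth _ _ (by tauto) _ (hf _) _ (hf _)
  · simp_all

/-! ### Pairs of forms and the variational comparison -/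

section FormPair

variable {M A C : Type} [AddCommGroup M] [Module ℝ M] [NormedAddCommGroup A]
  [InnerProductSpace ℝ A] [NormedAddCommGroup C] [InnerProductSpace ℝ C]

/-- The eigenspace of the form `⟪d f, d g⟫` with respect to the form `⟪J f, J g⟫`. -/
def formEigenspace (d : M →ₗ[ℝ] A) (J : M →ₗ[ℝ] C) (l : ℝ) : Submodule ℝ M where
  carrier := {f | ∀ g, inner ℝ (d f) (d g) = l * inner ℝ (J f) (J g)}
  add_mem' := fun {f f'} hf hf' g => by
    simp only [map_add, inner_add_left, hf g, hf' g, mul_add]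
  zero_mem' := fun g => by simp
  smul_mem' := fun s f hf g => by
    simp only [map_smul, inner_smul_left, hf g]
    simp; ring

variable {d : M →ₗ[ℝ] A} {J : M →ₗ[ℝ] C}

theorem formEigenspace_orthogonal {l l' : ℝ} (h : l ≠ l') {f g : M}
    (hf : f ∈ formEigenspace d J l) (hg : g ∈ formEigenspace d J l') :
    inner ℝ (J f) (J g) = 0 := by
  have h1 := hf g
  have h2 := hg f
  rw [real_inner_comm, real_inner_comm (J f)] at h2
  have h3 : (l - l') * inner ℝ (J f) (J g) = 0 := by linarith
  exact (mul_eq_zero.1 h3).resolve_left (sub_ne_zero.2 h)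

/-- `J` is not assumed injective: an H¹ function that vanishes on the support of μ is zero in L²(μ).
Testing the eigenvalue equation with the eigenvector itself excludes such functions. -/
theorem eq_zero_of_mem_formEigenspace (hinj : ∀ f, d f = 0 → J f = 0 → f = 0) {l : ℝ} {f : M}
    (hf : f ∈ formEigenspace d J l) (h : J f = 0) : f = 0 := by
  refine hinj f ?_ h
  have := hf f
  rwa [h, inner_zero_left, mul_zero, inner_self_eq_zero] at this

theorem iSupIndep_formEigenspace (hinj : ∀ f, d f = 0 → J f = 0 → f = 0) :
    iSupIndep (formEigenspace d J) := by
  rw [iSupIndep_iff_finsetSum_eq_zero_imp_eq_zero]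
  intro s v hv hsum i hi
  refine eq_zero_of_mem_formEigenspace hinj (hv i hi) ?_
  have h : inner ℝ (J (v i)) (J (∑ j ∈ s, v j)) = 0 := by rw [hsum]; simp
  rw [map_sum, inner_sum, Finset.sum_eq_single i] at h
  · exact inner_self_eq_zero.1 h
  · exact fun j hj hji => formEigenspace_orthogonal (Ne.symm hji) (hv i hi) (hv j hj)
  · exact fun h => (h hi).elim

variable (d J) in
/-- The span of the eigenspaces for the eigenvalues `l ≤ x`. -/
def spectralSubspace (x : ℝ) : Submodule ℝ M := ⨆ l : Iic x, formEigenspace d J l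

theorem toENat_rank_spectralSubspace (hinj : ∀ f, d f = 0 → J f = 0 → f = 0) (x : ℝ) :
    Cardinal.toENat (Module.rank ℝ (spectralSubspace d J x)) =
      ∑' l : Iic x, Cardinal.toENat (Module.rank ℝ (formEigenspace d J l)) :=
  toENat_rank_iSup _ ((iSupIndep_formEigenspace hinj).comp Subtype.val_injective)

theorem norm_sq_le_of_mem_spectralSubspace {x : ℝ} {f : M} (hf : f ∈ spectralSubspace d J x) :
    ‖d f‖ ^ 2 ≤ x * ‖J f‖ ^ 2 := by
  have h := nonneg_of_mem_iSup
    (x • (innerₗ C).compl₁₂ J J - (innerₗ A).compl₁₂ d d) _ ?_ ?_ hf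
  · simp at h
    linarith
  · rintro ⟨l, hl⟩ g hg
    have := hg g
    simp only [real_inner_self_eq_norm_sq] at this
    simp [this]
    exact mul_le_mul_of_nonneg_right hl (sq_nonneg _)
  · intro i j hij g hg g' hg'
    have h1 := formEigenspace_orthogonal (fun h => hij (Subtype.ext h)) hg hg'
    simp [h1, hg g']

variable (d J) in
/-- Vectors that are orthogonal to all eigenvectors for eigenvalues `l ≤ x` have a Rayleigh
quotient larger than `x`. -/
def IsSpectral : Prop :=
  ∀ x : ℝ, 0 ≤ x → ∀ f, (∀ e ∈ spectralSubspace d J x, inner ℝ (J f) (J e) = 0) →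
    f = 0 ∨ x * ‖J f‖ ^ 2 < ‖d f‖ ^ 2

/-- Allows the form domain to be replaced by a parameter space that carries a complete norm. -/
theorem IsSpectral.of_equiv {P : Type} [AddCommGroup P] [Module ℝ P] (e : P ≃ₗ[ℝ] M)
    (h : IsSpectral (d ∘ₗ (e : P →ₗ[ℝ] M)) (J ∘ₗ (e : P →ₗ[ℝ] M))) : IsSpectral d J := by
  intro x hx f hf
  have h1 := h x hx (e.symm f) ?_
  · simpa using h1
  · intro p hp
    simp only [LinearMap.coe_comp, LinearEquiv.coe_coe, Function.comp_apply,
      LinearEquiv.apply_symm_apply]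
    refine hf _ ?_
    have h2 : spectralSubspace (d ∘ₗ (e : P →ₗ[ℝ] M)) (J ∘ₗ (e : P →ₗ[ℝ] M)) x ≤
        (spectralSubspace d J x).comap (e : P →ₗ[ℝ] M) := by
      refine iSup_le fun l q hq => ?_
      refine Submodule.mem_iSup_of_mem l fun g => ?_
      simpa using hq (e.symm g)
    exact h2 hp

end FormPair

section Comparison

variable {ι M : Type} [Fintype ι] [AddCommGroup M] [Module ℝ M]
  {N A C : ι → Type} [∀ i, AddCommGroup (N i)] [∀ i, Module ℝ (N i)]
  [∀ i, NormedAddCommGroup (A i)] [∀ i, InnerProductSpace ℝ (A i)]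
  [∀ i, NormedAddCommGroup (C i)] [∀ i, InnerProductSpace ℝ (C i)]
  {d : (i : ι) → N i →ₗ[ℝ] A i} {J : (i : ι) → N i →ₗ[ℝ] C i}

/-- Pair f with the i-th spectral subspace through ⟨J (R i f), J e⟩. If all these pairings vanish,
the spectral property places every R i f in the alternative of `h`, so f = 0; the pairings therefore
separate the points of M. -/
theorem toENat_rank_le_sum_spectralSubspace (hs : ∀ i, IsSpectral (d i) (J i))
    (R : (i : ι) → M →ₗ[ℝ] N i) (x : ι → ℝ) (hx : ∀ i, 0 ≤ x i)
    (h : ∀ f, (∀ i, R i f = 0 ∨ x i * ‖J i (R i f)‖ ^ 2 < ‖d i (R i f)‖ ^ 2) → f = 0) :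
    Cardinal.toENat (Module.rank ℝ M) ≤
      ∑ i, Cardinal.toENat (Module.rank ℝ (spectralSubspace (d i) (J i) (x i))) := by
  refine toENat_rank_le_sum (fun i => ((innerₗ (C i)).compl₁₂ (J i ∘ₗ R i)
    (J i ∘ₗ (spectralSubspace (d i) (J i) (x i)).subtype))) fun f hf => h f fun i => ?_
  refine hs i (x i) (hx i) (R i f) fun e he => ?_
  simpa using LinearMap.congr_fun (hf i) ⟨e, he⟩

end Comparison

/-! ### Compact embeddings have the spectral property -/

/-- On the orthogonal complement of the eigenspaces for eigenvalues at least `κ₀`, the quadratic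
form of a compact self-adjoint operator is less than `κ₀`. -/
theorem inner_lt_of_orthogonal_eigenspace {H : Type*} [NormedAddCommGroup H]
    [InnerProductSpace ℝ H] [CompleteSpace H] {T : H →L[ℝ] H} (hT : IsCompactOperator T)
    (hT' : (T : H →ₗ[ℝ] H).IsSymmetric) {κ₀ : ℝ} {f : H}
    (hf : ∀ κ, κ₀ ≤ κ → ∀ e, T e = κ • e → inner ℝ f e = 0) :
    f = 0 ∨ inner ℝ (T f) f < κ₀ * inner ℝ f f := by
  have hbot := ContinuousLinearMap.orthogonalComplement_iSup_eigenspaces_eq_bot hT hT'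
  have hzero : ∀ y : H, (∀ (κ : ℝ) (e : H), T e = κ • e → inner ℝ y e = 0) → y = 0 := by
    intro y hy
    have : y ∈ (⨆ μ, Module.End.eigenspace (T : Module.End ℝ H) μ)ᗮ := by
      rw [Submodule.mem_orthogonal']
      intro u hu
      induction hu using Submodule.iSup_induction' with
      | mem κ e he => exact hy κ e (Module.End.mem_eigenspace_iff.1 he)
      | zero => simp
      | add u v _ _ hu hv => rw [inner_add_right, hu, hv, add_zero]
    rw [hbot] at this
    exact this
  have horth : ∀ κ κ' : ℝ, κ ≠ κ' → ∀ e e' : H, T e = κ • e → T e' = κ' • e' → inner ℝ e e' = 0 := by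
    intro κ κ' h e e' he he'
    have h1 := hT' e e'
    simp only [ContinuousLinearMap.coe_coe, he, he', inner_smul_left, inner_smul_right,
      conj_trivial] at h1
    have h2 : (κ - κ') * inner ℝ e e' = 0 := by linarith
    exact (mul_eq_zero.1 h2).resolve_left (sub_ne_zero.2 h)
  set N : Submodule ℝ H := ⨆ κ : Iio κ₀, Module.End.eigenspace (T : Module.End ℝ H) κ
  have hNmem : ∀ κ < κ₀, ∀ e, T e = κ • e → e ∈ N.topologicalClosure := fun κ hκ e he =>
    N.le_topologicalClosure
      (Submodule.mem_iSup_of_mem ⟨κ, hκ⟩ (Module.End.mem_eigenspace_iff.2 he))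
  -- The difference between f and its projection is orthogonal to every eigenvector: those below κ₀
  -- lie in the closure of N, and those from κ₀ on are orthogonal both to f and to N.
  have hfN : f ∈ N.topologicalClosure := by
    have : CompleteSpace N.topologicalClosure :=
      N.isClosed_topologicalClosure.completeSpace_coe
    have h0 : f - N.topologicalClosure.starProjection f = 0 := by
      refine hzero _ fun κ e he => ?_
      rcases lt_or_ge κ κ₀ with hκ | hκ
      · exact Submodule.starProjection_inner_eq_zero f e (hNmem κ hκ e he)
      · rw [inner_sub_left, hf κ hκ e he, zero_sub, neg_eq_zero]
        have h1 : N.topologicalClosure ≤ (ℝ ∙ e)ᗮ := by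
          refine N.topologicalClosure_minimal ?_ (Submodule.isClosed_orthogonal _)
          refine iSup_le fun κ' u hu => ?_
          rw [Submodule.mem_orthogonal_singleton_iff_inner_left]
          exact horth κ' κ (κ'.2.trans_le hκ).ne _ _ (Module.End.mem_eigenspace_iff.1 hu) he
        exact (Submodule.mem_orthogonal_singleton_iff_inner_left).1
          (h1 (Submodule.starProjection_apply_mem _ f))
    rw [sub_eq_zero.1 h0]
    exact Submodule.starProjection_apply_mem _ f
  let Q : H →ₗ[ℝ] H →ₗ[ℝ] ℝ := κ₀ • innerₗ H - (innerₗ H).compl₁₂ (T : H →ₗ[ℝ] H) LinearMap.id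
  have hQ : ∀ u v, Q u v = κ₀ * inner ℝ u v - inner ℝ (T u) v := fun u v => by simp [Q]
  have hQpos : ∀ u ∈ N.topologicalClosure, 0 ≤ Q u u := by
    have hcl : IsClosed {u | 0 ≤ Q u u} := by
      simp only [hQ]
      exact isClosed_le continuous_const (by fun_prop)
    refine fun u hu => closure_minimal (fun u hu => ?_) hcl hu
    refine nonneg_of_mem_iSup Q _ ?_ ?_ hu
    · rintro ⟨κ, hκ⟩ v hv
      have hv := Module.End.mem_eigenspace_iff.1 hv
      simp only [ContinuousLinearMap.coe_coe] at hv
      rw [hQ, hv, inner_smul_left, conj_trivial, ← sub_mul]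
      exact mul_nonneg (sub_nonneg.2 hκ.le) real_inner_self_nonneg
    · rintro ⟨κ, hκ⟩ ⟨κ', hκ'⟩ hne v hv w hw
      have hv := Module.End.mem_eigenspace_iff.1 hv
      have hw := Module.End.mem_eigenspace_iff.1 hw
      simp only [ContinuousLinearMap.coe_coe] at hv hw
      have h1 := horth κ κ' (fun h => hne (Subtype.ext h)) v w hv hw
      rw [hQ, hv, inner_smul_left, h1, mul_zero, mul_zero, sub_zero]
  -- For the strict inequality: if Q f f = 0, Cauchy–Schwarz for the nonnegative form Q makes Q f
  -- vanish on the closure of N. Then κ₀ f − T f is orthogonal to all eigenvectors, so f is an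
  -- eigenvector for κ₀ and by hypothesis orthogonal to itself.
  rw [or_iff_not_imp_right, not_lt]
  intro hle
  have hQf : Q f f = 0 := le_antisymm (by rw [hQ]; linarith) (hQpos f hfN)
  have hQ0 : ∀ g ∈ N.topologicalClosure, Q f g = 0 := by
    intro g hg
    have h1 := LinearMap.BilinForm.apply_mul_apply_le_of_forall_zero_le
      (Q.domRestrict₁₂ N.topologicalClosure N.topologicalClosure)
      (fun u => hQpos u u.2) ⟨f, hfN⟩ ⟨g, hg⟩
    simp only [LinearMap.domRestrict₁₂_apply, hQf, zero_mul] at h1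
    have h2 : Q g f = Q f g := by
      have h3 := hT' g f
      simp only [ContinuousLinearMap.coe_coe] at h3
      rw [hQ, hQ, h3, real_inner_comm, real_inner_comm g (T f)]
    rw [h2] at h1
    exact mul_self_eq_zero.1 (le_antisymm h1 (mul_self_nonneg _))
  have hev : κ₀ • f - T f = 0 := by
    refine hzero _ fun κ e he => ?_
    have h3 : inner ℝ (κ₀ • f - T f) e = Q f e := by
      rw [hQ, inner_sub_left, inner_smul_left, conj_trivial]
    rcases lt_or_ge κ κ₀ with hκ | hκ
    · rw [h3, hQ0 e (hNmem κ hκ e he)]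
    · rw [h3, hQ, hf κ hκ e he, mul_zero, zero_sub, neg_eq_zero]
      have h4 := hT' f e
      simp only [ContinuousLinearMap.coe_coe] at h4
      rw [h4, he, inner_smul_right, hf κ hκ e he, mul_zero]
  have := hf κ₀ le_rfl f (sub_eq_zero.1 hev).symm
  exact inner_self_eq_zero.1 this

/-- The inner product ⟨d·, d·⟩ + ⟨J·, J·⟩ is realised on the range of (d, J), which is complete by
`hc`. With j the map induced by J on this range, j*j is compact and self-adjoint. Its eigenvalues κ
> 0 correspond to the eigenvalues κ⁻¹ − 1 of the form, so eigenvalues at most x correspond to κ ≥ (1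
+ x)⁻¹. -/
theorem isSpectral_of_isCompactOperator {P A C : Type} [NormedAddCommGroup P] [NormedSpace ℝ P]
    [CompleteSpace P] [NormedAddCommGroup A] [InnerProductSpace ℝ A] [CompleteSpace A]
    [NormedAddCommGroup C] [InnerProductSpace ℝ C] [CompleteSpace C] (d : P →L[ℝ] A)
    (J : P →L[ℝ] C) (hJ : IsCompactOperator J) {c : NNReal}
    (hc : ∀ p, ‖p‖ ≤ c * (‖d p‖ + ‖J p‖)) :
    IsSpectral (d : P →ₗ[ℝ] A) (J : P →ₗ[ℝ] C) := by
  let Φ : P →L[ℝ] WithLp 2 (A × C) :=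
    ((WithLp.prodContinuousLinearEquiv 2 ℝ A C).symm : A × C →L[ℝ] WithLp 2 (A × C)) ∘L d.prod J
  have hΦi : ∀ p q, inner ℝ (Φ p) (Φ q) = inner ℝ (d p) (d q) + inner ℝ (J p) (J q) := by
    intro p q
    simp [Φ, WithLp.prod_inner_apply]
  have hΦd : ∀ p, ‖d p‖ ≤ ‖Φ p‖ := fun p => by
    refine abs_le_of_sq_le_sq' ?_ (norm_nonneg _) |>.2
    rw [← real_inner_self_eq_norm_sq, ← real_inner_self_eq_norm_sq, hΦi]
    linarith [real_inner_self_nonneg (x := J p)]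
  have hΦJ : ∀ p, ‖J p‖ ≤ ‖Φ p‖ := fun p => by
    refine abs_le_of_sq_le_sq' ?_ (norm_nonneg _) |>.2
    rw [← real_inner_self_eq_norm_sq, ← real_inner_self_eq_norm_sq, hΦi]
    linarith [real_inner_self_nonneg (x := d p)]
  have hanti : AntilipschitzWith (c * 2) Φ := by
    refine ContinuousLinearMap.antilipschitz_of_bound Φ fun p => (hc p).trans ?_
    push_cast
    rw [mul_assoc]
    exact mul_le_mul_of_nonneg_left (by linarith [hΦd p, hΦJ p]) c.2
  have hinj : Function.Injective Φ := hanti.injective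
  have hclosed : IsClosed (range Φ) := hanti.isClosed_range Φ.uniformContinuous
  have : CompleteSpace Φ.range :=
    (hanti.isComplete_range Φ.uniformContinuous).completeSpace_coe
  let e := Φ.equivRange hinj hclosed
  have he : ∀ p, ((e p : Φ.range) : WithLp 2 (A × C)) = Φ p := fun p => by simp [e]
  let j : Φ.range →L[ℝ] C := J ∘L (e.symm : Φ.range →L[ℝ] P)
  have hj : IsCompactOperator j := hJ.comp_clm _
  let T : Φ.range →L[ℝ] Φ.range := (ContinuousLinearMap.adjoint j) ∘L j
  have hTi : ∀ u v, inner ℝ (T u) v = inner ℝ (j u) (j v) := fun u v => by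
    simp only [T, ContinuousLinearMap.comp_apply, ContinuousLinearMap.adjoint_inner_left]
  have hT : IsCompactOperator T := hj.clm_comp (ContinuousLinearMap.adjoint j)
  have hT' : (T : Φ.range →ₗ[ℝ] Φ.range).IsSymmetric := fun u v => by
    simp only [ContinuousLinearMap.coe_coe]
    rw [hTi, real_inner_comm (T v), hTi, real_inner_comm]
  intro x hx f hf
  have hx1 : 0 < 1 + x := by linarith
  have h := inner_lt_of_orthogonal_eigenspace hT hT' (κ₀ := (1 + x)⁻¹) (f := e f) ?_
  · have hjf : j (e f) = J f := by simp [j]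
    rw [hTi, hjf, Submodule.coe_inner, he, hΦi] at h
    rcases h with h | h
    · left
      simpa using h
    · right
      rw [inv_mul_eq_div, lt_div_iff₀ hx1] at h
      simp only [real_inner_self_eq_norm_sq] at h
      simp only [ContinuousLinearMap.coe_coe]
      linarith
  · intro κ hκ u hu
    have hκ0 : 0 < κ := (inv_pos.2 hx1).trans_le hκ
    obtain ⟨q, rfl⟩ := e.surjective u
    have hκ1 : κ⁻¹ - 1 ≤ x := by
      have := inv_anti₀ (inv_pos.2 hx1) hκ
      rw [inv_inv] at this
      linarith
    have hq : ∀ g, inner ℝ (J q) (J g) = κ * (inner ℝ (d q) (d g) + inner ℝ (J q) (J g)) := by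
      intro g
      have h1 := hTi (e q) (e g)
      rw [hu, inner_smul_left, conj_trivial, Submodule.coe_inner, he, he, hΦi] at h1
      simpa [j] using h1.symm
    have hq' : q ∈ spectralSubspace (d : P →ₗ[ℝ] A) (J : P →ₗ[ℝ] C) x := by
      refine Submodule.mem_iSup_of_mem ⟨κ⁻¹ - 1, hκ1⟩ fun g => ?_
      have := hq g
      simp only [ContinuousLinearMap.coe_coe]
      field_simp
      linarith
    have h2 := hf q hq'
    simp only [ContinuousLinearMap.coe_coe] at h2
    rw [Submodule.coe_inner, he, he, hΦi, real_inner_comm, real_inner_comm (J q)]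
    have h3 := hq f
    rw [real_inner_comm, h2] at h3
    have h4 := (mul_eq_zero.1 h3.symm).resolve_left hκ0.ne'
    rw [real_inner_comm (J f)] 
    linarith

/-! ### The Sobolev space, parametrized by the value at a and the derivative -/

namespace IFSFamily

variable {J : Type*} (D : IFSFamily J)

/-- The space `L²([a, b])` with respect to Lebesgue measure. -/
abbrev L2 : Type := Lp ℝ 2 (volume.restrict (Icc D.a D.b))

/-- The indicator function of `(a, x]` as an element of `L²([a, b])`. -/
noncomputable def stepFn (x : D.X) : D.L2 :=
  indicatorConstLp 2 (measurableSet_Ioc (a := D.a) (b := (x : ℝ))) (measure_ne_top _ _) 1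

/-- Evaluation of a primitive is an inner product with an indicator function; norm bounds and
equicontinuity of primitives thus reduce to properties of `stepFn`. -/
theorem inner_stepFn (x : D.X) (u : D.L2) : inner ℝ (D.stepFn x) u = ∫ t in D.a..x, u t := by
  rw [stepFn, L2.inner_indicatorConstLp_one, intervalIntegral.integral_of_le x.2.1,
    Measure.restrict_restrict measurableSet_Ioc,
    inter_eq_left.2 (Ioc_subset_Icc_self.trans (Icc_subset_Icc_right x.2.2))]

/-- The difference is the indicator of (x, y], whose squared norm is a length. This is the
Hölder-1/2 continuity of H¹ functions. -/
theorem norm_stepFn_sub (x y : D.X) (h : x ≤ y) :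
    ‖D.stepFn y - D.stepFn x‖ ≤ Real.sqrt (dist x y) := by
  have h1 : D.stepFn y - D.stepFn x = indicatorConstLp 2
      (measurableSet_Ioc (a := (x : ℝ)) (b := (y : ℝ)))
      (measure_ne_top (volume.restrict (Icc D.a D.b)) _) 1 := by
    rw [sub_eq_iff_eq_add, stepFn, stepFn, ← indicatorConstLp_disjoint_union]
    · congr 1
      rw [union_comm, Ioc_union_Ioc_eq_Ioc x.2.1 h]
    · rw [Set.disjoint_left]
      exact fun t ht ht' => ht.1.not_ge ht'.2
  rw [h1, norm_indicatorConstLp (by norm_num) (by norm_num), norm_one, one_mul,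
    Real.sqrt_eq_rpow]
  norm_num
  refine Real.rpow_le_rpow measureReal_nonneg ?_ (by norm_num)
  refine (measureReal_mono inter_subset_left measure_Ioc_lt_top.ne).trans_eq ?_
  rw [Real.volume_real_Ioc_of_le h, Subtype.dist_eq, dist_comm, Real.dist_eq,
    abs_of_nonneg (sub_nonneg.2 (show (x : ℝ) ≤ y from h))]

theorem continuous_stepFn : Continuous D.stepFn := by
  rw [Metric.continuous_iff]
  intro x ε hε
  refine ⟨ε ^ 2, by positivity, fun y hy => ?_⟩
  have h : dist (D.stepFn y) (D.stepFn x) ≤ Real.sqrt (dist y x) := by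
    rcases le_total x y with h | h
    · rw [dist_eq_norm, dist_comm]; exact D.norm_stepFn_sub x y h
    · rw [dist_comm, dist_eq_norm]; exact D.norm_stepFn_sub y x h
  refine h.trans_lt ?_
  rw [Real.sqrt_lt' hε]
  exact hy

theorem norm_stepFn_le (x : D.X) : ‖D.stepFn x‖ ≤ Real.sqrt (D.b - D.a) := by
  rw [stepFn, norm_indicatorConstLp (by norm_num) (by norm_num), norm_one, one_mul,
    Real.sqrt_eq_rpow]
  norm_num
  refine Real.rpow_le_rpow measureReal_nonneg ?_ (by norm_num)
  refine (measureReal_mono inter_subset_right measure_Icc_lt_top.ne).trans_eq ?_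
  rw [Real.volume_real_Icc_of_le D.a_lt_b.le]

/-- The function `c + ∫ₐˣ u` as a bounded continuous function. -/
noncomputable def primitiveBCF : (ℝ × D.L2) →L[ℝ] BoundedContinuousFunction D.X ℝ :=
  LinearMap.mkContinuous
    { toFun := fun p => BoundedContinuousFunction.mkOfCompact
        ⟨fun x => p.1 + inner ℝ (D.stepFn x) p.2,
          continuous_const.add (D.continuous_stepFn.inner continuous_const)⟩
      map_add' := fun p q => by
        ext x
        simp [inner_add_right]; ring
      map_smul' := fun s p => by
        ext x
        simp [inner_smul_right]; ring }
    (1 + Real.sqrt (D.b - D.a)) fun p => by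
      rw [BoundedContinuousFunction.norm_le (by positivity)]
      intro x
      have h1 := norm_inner_le_norm (𝕜 := ℝ) (D.stepFn x) p.2
      have h2 := mul_le_mul (D.norm_stepFn_le x) (norm_snd_le p) (norm_nonneg _)
        (Real.sqrt_nonneg _)
      have h3 := norm_fst_le p
      have h4 := norm_add_le p.1 (inner ℝ (D.stepFn x) p.2)
      simp only [LinearMap.coe_mk, AddHom.coe_mk, BoundedContinuousFunction.mkOfCompact_apply,
        ContinuousMap.coe_mk]
      linarith

theorem primitiveBCF_apply (p : ℝ × D.L2) (x : D.X) :
    D.primitiveBCF p x = p.1 + inner ℝ (D.stepFn x) p.2 := rfl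

theorem primitiveBCF_left (p : ℝ × D.L2) : D.primitiveBCF p D.left = p.1 := by
  rw [primitiveBCF_apply, inner_stepFn]
  simp [left]

theorem isWeakDeriv_primitiveBCF (p : ℝ × D.L2) : D.IsWeakDeriv (D.primitiveBCF p) p.2 := by
  refine ⟨Lp.memLp _, fun x => ?_⟩
  rw [primitiveBCF_left, primitiveBCF_apply, inner_stepFn]

/-- Arzelà–Ascoli: on the unit ball the primitives are uniformly bounded, and continuity of `stepFn`
makes them equicontinuous. -/
theorem isCompactOperator_primitiveBCF : IsCompactOperator D.primitiveBCF := by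
  refine (isCompactOperator_iff_isCompact_closure_image_ball
    (D.primitiveBCF : (ℝ × D.L2) →ₗ[ℝ] BoundedContinuousFunction D.X ℝ) one_pos).2 ?_
  refine BoundedContinuousFunction.arzela_ascoli (Metric.closedBall 0 ‖D.primitiveBCF‖)
    (isCompact_closedBall _ _) _ ?_ ?_
  · rintro _ x ⟨p, hp, rfl⟩
    rw [mem_closedBall_zero_iff]
    refine (BoundedContinuousFunction.norm_coe_le_norm _ x).trans
      ((D.primitiveBCF.le_opNorm p).trans ?_)
    exact mul_le_of_le_one_right (norm_nonneg _) (mem_ball_zero_iff.1 hp).le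
  · intro x
    rw [Metric.equicontinuousAt_iff]
    intro ε hε
    obtain ⟨δ, hδ, h⟩ := Metric.continuous_iff.1 D.continuous_stepFn x ε hε
    refine ⟨δ, hδ, fun y hy => ?_⟩
    rintro ⟨_, p, hp, rfl⟩
    have h1 := h y hy
    simp only [ContinuousLinearMap.coe_coe, primitiveBCF_apply, dist_add_left]
    rw [Real.dist_eq, ← inner_sub_left, ← Real.norm_eq_abs]
    rw [dist_comm, dist_eq_norm] at h1
    refine (norm_inner_le_norm _ _).trans_lt (lt_of_le_of_lt ?_ h1)
    refine mul_le_of_le_one_right (norm_nonneg _) ?_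
    exact (norm_snd_le p).trans (mem_ball_zero_iff.1 hp).le

variable {D}

/-- By Lebesgue differentiation, u is almost everywhere the derivative of its primitive, which is
zero. -/
theorem ae_eq_zero_of_integral_eq_zero {u : ℝ → ℝ}
    (hu : MemLp u 2 (volume.restrict (Icc D.a D.b)))
    (h : ∀ x : D.X, ∫ t in D.a..(x : ℝ), u t = 0) : u =ᵐ[volume.restrict (Icc D.a D.b)] 0 := by
  have hi : IntervalIntegrable u volume D.a D.b := by
    rw [intervalIntegrable_iff_integrableOn_Icc_of_le D.a_lt_b.le]
    exact hu.integrable (by norm_num)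
  rw [Measure.restrict_congr_set Ioo_ae_eq_Icc.symm]
  rw [EventuallyEq, ae_restrict_iff' measurableSet_Ioo]
  filter_upwards [hi.ae_hasDerivAt_integral] with x hx hx'
  have h1 := hx (by rw [uIcc_of_le D.a_lt_b.le]; exact Ioo_subset_Icc_self hx') D.a left_mem_uIcc
  refine h1.unique (HasDerivAt.congr_of_eventuallyEq (hasDerivAt_const x (0 : ℝ)) ?_)
  filter_upwards [Ioo_mem_nhds hx'.1 hx'.2] with y hy
  exact h ⟨y, Ioo_subset_Icc_self hy⟩

theorem IsWeakDeriv.ae_eq {f : D.X → ℝ} {u v : ℝ → ℝ} (hu : D.IsWeakDeriv f u)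
    (hv : D.IsWeakDeriv f v) : u =ᵐ[volume.restrict (Icc D.a D.b)] v := by
  have h := ae_eq_zero_of_integral_eq_zero (hu.1.sub hv.1) fun x => by
    simp only [Pi.sub_apply]
    rw [intervalIntegral.integral_sub (hu.intervalIntegrable x) (hv.intervalIntegrable x)]
    linarith [hu.2 x, hv.2 x]
  exact (h.mono fun t ht => sub_eq_zero.1 ht)

variable (D)

/-- The parametrization `(c, u) ↦ c + ∫ₐˣ u` of the Sobolev space. -/
noncomputable def sobolevEquiv : (ℝ × D.L2) ≃ₗ[ℝ] D.sobolev :=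
  LinearEquiv.ofBijective
    { toFun := fun p => ⟨D.primitiveBCF p, p.2, D.isWeakDeriv_primitiveBCF p⟩
      map_add' := fun p q => by ext x; simp
      map_smul' := fun s p => by ext x; simp } <| by
    constructor
    · rw [injective_iff_map_eq_zero]
      intro p hp
      have hp' : ∀ x, D.primitiveBCF p x = 0 := fun x => congrFun (Subtype.ext_iff.1 hp) x
      have h1 : p.1 = 0 := by rw [← D.primitiveBCF_left, hp']
      refine Prod.ext h1 ?_
      have h2 := ae_eq_zero_of_integral_eq_zero (Lp.memLp p.2) fun x => by
        have := hp' x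
        rwa [primitiveBCF_apply, inner_stepFn, h1, zero_add] at this
      exact (Lp.eq_zero_iff_ae_eq_zero).2 h2
    · rintro ⟨f, u, hu⟩
      refine ⟨(f D.left, hu.1.toLp u), Subtype.ext (funext fun x => ?_)⟩
      simp only [LinearMap.coe_mk, AddHom.coe_mk, primitiveBCF_apply, inner_stepFn]
      rw [hu.2 x]
      congr 1
      refine intervalIntegral.integral_congr_ae ?_
      have := (ae_restrict_iff' measurableSet_Icc).1 hu.1.coeFn_toLp
      filter_upwards [this] with t ht ht'
      rw [uIoc_of_le x.2.1] at ht'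
      exact ht ⟨ht'.1.le, ht'.2.trans x.2.2⟩

theorem sobolevEquiv_apply (p : ℝ × D.L2) (x : D.X) :
    (D.sobolevEquiv p : D.X → ℝ) x = D.primitiveBCF p x := rfl

/-- The weak derivative. -/
noncomputable def weakDeriv : D.sobolev →ₗ[ℝ] D.L2 :=
  LinearMap.snd ℝ ℝ D.L2 ∘ₗ (D.sobolevEquiv.symm : D.sobolev →ₗ[ℝ] ℝ × D.L2)

theorem isWeakDeriv_weakDeriv (f : D.sobolev) : D.IsWeakDeriv f (D.weakDeriv f) := by
  obtain ⟨p, rfl⟩ := D.sobolevEquiv.surjective f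
  have : D.weakDeriv (D.sobolevEquiv p) = p.2 := by simp [weakDeriv]
  rw [this]
  exact D.isWeakDeriv_primitiveBCF p

variable {D} in
theorem IsWeakDeriv.weakDeriv_ae_eq {f : D.sobolev} {u : ℝ → ℝ} (hu : D.IsWeakDeriv f u) :
    D.weakDeriv f =ᵐ[volume.restrict (Icc D.a D.b)] u :=
  (D.isWeakDeriv_weakDeriv f).ae_eq hu

theorem inner_weakDeriv {f g : D.sobolev} {u v : ℝ → ℝ} (hu : D.IsWeakDeriv f u)
    (hv : D.IsWeakDeriv g v) :
    inner ℝ (D.weakDeriv f) (D.weakDeriv g) = ∫ t in D.a..D.b, u t * v t := by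
  rw [L2.inner_def, intervalIntegral.integral_of_le D.a_lt_b.le, ← integral_Icc_eq_integral_Ioc]
  refine integral_congr_ae ?_
  filter_upwards [hu.weakDeriv_ae_eq, hv.weakDeriv_ae_eq] with t h1 h2
  simp [h1, h2, mul_comm]

theorem norm_sq_weakDeriv {f : D.sobolev} {u : ℝ → ℝ} (hu : D.IsWeakDeriv f u) :
    ‖D.weakDeriv f‖ ^ 2 = ∫ t in D.a..D.b, u t ^ 2 := by
  rw [← real_inner_self_eq_norm_sq, D.inner_weakDeriv hu hu]
  simp only [sq]

/-- The embedding of the bounded continuous functions into `L²(μ)`. -/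
noncomputable abbrev bcfToL2 (μ : ProbabilityMeasure D.X) :
    BoundedContinuousFunction D.X ℝ →L[ℝ] Lp ℝ 2 (μ : Measure D.X) :=
  BoundedContinuousFunction.toLp 2 (μ : Measure D.X) ℝ

/-- The embedding of the Sobolev space into `L²(μ)`. -/
noncomputable def toL2 (μ : ProbabilityMeasure D.X) : D.sobolev →ₗ[ℝ] Lp ℝ 2 (μ : Measure D.X) :=
  (D.bcfToL2 μ ∘L D.primitiveBCF : (ℝ × D.L2) →ₗ[ℝ] _) ∘ₗ
    (D.sobolevEquiv.symm : D.sobolev →ₗ[ℝ] ℝ × D.L2)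

theorem toL2_ae_eq (μ : ProbabilityMeasure D.X) (f : D.sobolev) :
    D.toL2 μ f =ᵐ[(μ : Measure D.X)] f := by
  obtain ⟨p, rfl⟩ := D.sobolevEquiv.surjective f
  have : D.toL2 μ (D.sobolevEquiv p) = D.bcfToL2 μ (D.primitiveBCF p) := by simp [toL2]
  rw [this]
  exact BoundedContinuousFunction.coeFn_toLp _ _ _ _

theorem inner_toL2 (μ : ProbabilityMeasure D.X) (f g : D.sobolev) :
    inner ℝ (D.toL2 μ f) (D.toL2 μ g) =
      ∫ x, (f : D.X → ℝ) x * (g : D.X → ℝ) x ∂(μ : Measure D.X) := by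
  rw [L2.inner_def]
  refine integral_congr_ae ?_
  filter_upwards [D.toL2_ae_eq μ f, D.toL2_ae_eq μ g] with t h1 h2
  simp [h1, h2, mul_comm]

theorem norm_sq_toL2 (μ : ProbabilityMeasure D.X) (f : D.sobolev) :
    ‖D.toL2 μ f‖ ^ 2 = ∫ x, (f : D.X → ℝ) x ^ 2 ∂(μ : Measure D.X) := by
  rw [← real_inner_self_eq_norm_sq, D.inner_toL2]
  simp only [sq]

end IFSFamily

/-! ### Counting functions as dimensions, and the spectral property of both forms -/

namespace IFSFamily

variable {J : Type*} (D : IFSFamily J)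

section Domain

variable {F : Submodule ℝ (D.X → ℝ)} (hF : F ≤ D.sobolev) (μ : ProbabilityMeasure D.X)

/-- The weak derivative on a subspace of the Sobolev space. -/
noncomputable def derivOn : F →ₗ[ℝ] D.L2 := D.weakDeriv ∘ₗ Submodule.inclusion hF

/-- The embedding into `L²(μ)` of a subspace of the Sobolev space. -/
noncomputable def toL2On : F →ₗ[ℝ] Lp ℝ 2 (μ : Measure D.X) :=
  D.toL2 μ ∘ₗ Submodule.inclusion hF

/-- A function with zero derivative is constant, and since μ has total mass one, the L²(μ) norm of a
constant is its absolute value. -/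
theorem eq_zero_of_derivOn_eq_zero (f : F) (h1 : D.derivOn hF f = 0)
    (h2 : D.toL2On hF μ f = 0) : f = 0 := by
  obtain ⟨p, hp⟩ := D.sobolevEquiv.surjective (Submodule.inclusion hF f)
  have hp2 : p.2 = 0 := by
    rw [← h1, derivOn, LinearMap.comp_apply, ← hp]
    simp [weakDeriv]
  have hconst : ∀ x, (f : D.X → ℝ) x = p.1 := fun x => by
    have : (f : D.X → ℝ) x = D.primitiveBCF p x := by
      rw [← sobolevEquiv_apply, hp]; rfl
    rw [this, primitiveBCF_apply, hp2, inner_zero_right, add_zero]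
  have h3 : ‖D.toL2On hF μ f‖ ^ 2 = p.1 ^ 2 := by
    rw [toL2On, LinearMap.comp_apply, norm_sq_toL2]
    simp [hconst]
  rw [h2, norm_zero, zero_pow two_ne_zero] at h3
  ext x
  rw [hconst, pow_eq_zero_iff two_ne_zero |>.1 h3.symm]
  rfl

/-- Weak derivatives are unique almost everywhere, so the choice of representatives in `eigenspace`
does not matter. -/
theorem eigenspace_eq_map (l : ℝ) : D.eigenspace F μ l =
    (formEigenspace (D.derivOn hF) (D.toL2On hF μ) l).map F.subtype := by
  ext f
  constructor
  · rintro ⟨hf, u, hu, h⟩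
    refine ⟨⟨f, hf⟩, fun g => ?_, rfl⟩
    have hg := D.isWeakDeriv_weakDeriv (Submodule.inclusion hF g)
    have h1 := h g g.2 _ hg
    rw [derivOn, toL2On, LinearMap.comp_apply, LinearMap.comp_apply, LinearMap.comp_apply,
      LinearMap.comp_apply, D.inner_weakDeriv hu hg, D.inner_toL2]
    exact h1
  · rintro ⟨f, h, rfl⟩
    have hf := D.isWeakDeriv_weakDeriv (Submodule.inclusion hF f)
    refine ⟨f.2, _, hf, fun g hg v hv => ?_⟩
    have h1 := h ⟨g, hg⟩
    rw [derivOn, toL2On, LinearMap.comp_apply, LinearMap.comp_apply, LinearMap.comp_apply,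
      LinearMap.comp_apply, D.inner_weakDeriv hf hv, D.inner_toL2] at h1
    exact h1

theorem eigenvalueCount_eq (x : ℝ) : D.eigenvalueCount F μ x =
    Cardinal.toENat (Module.rank ℝ (spectralSubspace (D.derivOn hF) (D.toL2On hF μ) x)) := by
  rw [toENat_rank_spectralSubspace (D.eq_zero_of_derivOn_eq_zero hF μ), eigenvalueCount]
  refine tsum_congr fun l => ?_
  rw [D.eigenspace_eq_map hF,
    (Submodule.equivMapOfInjective _ F.injective_subtype _).rank_eq]

/-- The parameters of the functions in `F`. -/
noncomputable def paramSubmodule (F : Submodule ℝ (D.X → ℝ)) : Submodule ℝ (ℝ × D.L2) :=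
  F.comap (D.sobolev.subtype ∘ₗ (D.sobolevEquiv : (ℝ × D.L2) →ₗ[ℝ] D.sobolev))

/-- The parametrization of a subspace of the Sobolev space. -/
noncomputable def paramEquiv : D.paramSubmodule F ≃ₗ[ℝ] F :=
  LinearEquiv.ofBijective
    { toFun := fun p => ⟨D.sobolevEquiv p.1, p.2⟩
      map_add' := fun p q => by ext; simp
      map_smul' := fun s p => by ext; simp } <| by
    constructor
    · intro p q h
      have h := Subtype.ext_iff.1 h
      exact Subtype.ext (D.sobolevEquiv.injective (Subtype.ext h))
    · intro f
      obtain ⟨p, hp⟩ := D.sobolevEquiv.surjective (Submodule.inclusion hF f)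
      have hp' : (D.sobolevEquiv p : D.X → ℝ) = f := by rw [hp]; rfl
      exact ⟨⟨p, by change (D.sobolevEquiv p : D.X → ℝ) ∈ F; rw [hp']; exact f.2⟩,
        Subtype.ext hp'⟩

/-- The constant f(a) is f minus the primitive of f', and its L²(μ) norm is |f(a)|. Hence f in L²(μ)
and f' in L² control the parameters, wherever μ is supported. -/
theorem norm_param_le (p : ℝ × D.L2) : ‖p‖ ≤ (1 + ‖D.bcfToL2 μ ∘L D.primitiveBCF‖) *
    (‖p.2‖ + ‖D.bcfToL2 μ (D.primitiveBCF p)‖) := by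
  have h1 : ‖p.1‖ = ‖D.bcfToL2 μ (D.primitiveBCF (p.1, 0))‖ := by
    have h : ‖D.toL2 μ (D.sobolevEquiv (p.1, 0))‖ ^ 2 = p.1 ^ 2 := by
      rw [norm_sq_toL2]
      simp [sobolevEquiv_apply, primitiveBCF_apply]
    have h' : D.toL2 μ (D.sobolevEquiv (p.1, 0)) = D.bcfToL2 μ (D.primitiveBCF (p.1, 0)) := by
      simp [toL2]
    rw [h'] at h
    rw [Real.norm_eq_abs, ← Real.sqrt_sq_eq_abs, ← h, Real.sqrt_sq (norm_nonneg _)]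
  have h2 : p = (p.1, 0) + (0, p.2) := by simp
  have h3 : D.bcfToL2 μ (D.primitiveBCF (p.1, 0)) =
      D.bcfToL2 μ (D.primitiveBCF p) - D.bcfToL2 μ (D.primitiveBCF (0, p.2)) := by
    rw [← map_sub, ← map_sub]
    congr 2
    simp [Prod.sub_def]
  have h4 := (D.bcfToL2 μ ∘L D.primitiveBCF).le_opNorm (0, p.2)
  have h5 : ‖((0 : ℝ), p.2)‖ = ‖p.2‖ := by simp [Prod.norm_def]
  rw [h5] at h4
  simp only [ContinuousLinearMap.comp_apply] at h4
  have h6 := norm_sub_le (D.bcfToL2 μ (D.primitiveBCF p)) (D.bcfToL2 μ (D.primitiveBCF (0, p.2)))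
  rw [← h3, ← h1] at h6
  have h7 := mul_nonneg (norm_nonneg (D.bcfToL2 μ ∘L D.primitiveBCF))
    (norm_nonneg (D.bcfToL2 μ (D.primitiveBCF p)))
  have h8 := mul_nonneg (norm_nonneg (D.bcfToL2 μ ∘L D.primitiveBCF)) (norm_nonneg p.2)
  have h9 := norm_nonneg (D.bcfToL2 μ (D.primitiveBCF p))
  rw [Prod.norm_def]
  refine max_le ?_ ?_ <;> nlinarith [norm_nonneg p.2]

theorem isSpectral_of_isClosed (hcl : IsClosed (D.paramSubmodule F : Set (ℝ × D.L2))) :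
    IsSpectral (D.derivOn hF) (D.toL2On hF μ) := by
  have : CompleteSpace (D.paramSubmodule F) := hcl.completeSpace_coe
  refine IsSpectral.of_equiv (D.paramEquiv hF) ?_
  let d : D.paramSubmodule F →L[ℝ] D.L2 :=
    ContinuousLinearMap.snd ℝ ℝ D.L2 ∘L (D.paramSubmodule F).subtypeL
  let j : D.paramSubmodule F →L[ℝ] Lp ℝ 2 (μ : Measure D.X) :=
    (D.bcfToL2 μ ∘L D.primitiveBCF) ∘L (D.paramSubmodule F).subtypeL
  have hj : IsCompactOperator j :=
    (D.isCompactOperator_primitiveBCF.clm_comp (D.bcfToL2 μ)).comp_clm _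
  have h1 : D.derivOn hF ∘ₗ (D.paramEquiv hF : D.paramSubmodule F →ₗ[ℝ] F) =
      (d : D.paramSubmodule F →ₗ[ℝ] D.L2) := by
    ext1 p
    have : Submodule.inclusion hF (D.paramEquiv hF p) = D.sobolevEquiv p.1 := rfl
    simp [derivOn, weakDeriv, this, d]
  have h2 : D.toL2On hF μ ∘ₗ (D.paramEquiv hF : D.paramSubmodule F →ₗ[ℝ] F) =
      (j : D.paramSubmodule F →ₗ[ℝ] Lp ℝ 2 (μ : Measure D.X)) := by
    ext1 p
    have : Submodule.inclusion hF (D.paramEquiv hF p) = D.sobolevEquiv p.1 := rfl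
    simp [toL2On, toL2, this, j]
  rw [h1, h2]
  exact isSpectral_of_isCompactOperator d j hj
    (c := ⟨1 + ‖D.bcfToL2 μ ∘L D.primitiveBCF‖, by positivity⟩) fun p => D.norm_param_le μ p.1

end Domain

theorem sobolevZero_le : D.sobolevZero ≤ D.sobolev := fun _ h => h.1

theorem isSpectral_sobolev (μ : ProbabilityMeasure D.X) :
    IsSpectral (D.derivOn le_rfl) (D.toL2On (F := D.sobolev) le_rfl μ) := by
  refine D.isSpectral_of_isClosed le_rfl μ ?_
  have : (D.paramSubmodule D.sobolev : Set (ℝ × D.L2)) = univ :=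
    eq_univ_of_forall fun p => ⟨p.2, D.isWeakDeriv_primitiveBCF p⟩
  rw [this]
  exact isClosed_univ

theorem isSpectral_sobolevZero (μ : ProbabilityMeasure D.X) :
    IsSpectral (D.derivOn D.sobolevZero_le) (D.toL2On D.sobolevZero_le μ) := by
  refine D.isSpectral_of_isClosed D.sobolevZero_le μ ?_
  have : (D.paramSubmodule D.sobolevZero : Set (ℝ × D.L2)) =
      {p | D.primitiveBCF p D.left = 0} ∩ {p | D.primitiveBCF p D.right = 0} := by
    ext p
    exact ⟨fun h => h.2, fun h => ⟨⟨p.2, D.isWeakDeriv_primitiveBCF p⟩, h⟩⟩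
  rw [this]
  have hc : ∀ x, Continuous fun p => D.primitiveBCF p x := fun x => by
    simp only [primitiveBCF_apply]
    fun_prop
  exact (isClosed_eq (hc _) continuous_const).inter (isClosed_eq (hc _) continuous_const)

/-- The comparison is applied to the Dirichlet spectral subspace, included in the Neumann domain:
its vectors have Rayleigh quotient at most x for the same two forms. -/
theorem eigenvalueCount_sobolevZero_le (μ : ProbabilityMeasure D.X) {x : ℝ} (hx : 0 ≤ x) :
    D.eigenvalueCount D.sobolevZero μ x ≤ D.eigenvalueCount D.sobolev μ x := by
  rw [D.eigenvalueCount_eq D.sobolevZero_le, D.eigenvalueCount_eq le_rfl]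
  have h := toENat_rank_le_sum_spectralSubspace (ι := Unit)
    (M := spectralSubspace (D.derivOn D.sobolevZero_le) (D.toL2On D.sobolevZero_le μ) x)
    (fun _ => D.isSpectral_sobolev μ)
    (fun _ => (Submodule.inclusion D.sobolevZero_le).domRestrict _)
    (fun _ => x) (fun _ => hx) ?_
  · simpa using h
  · intro f hf
    rcases hf () with h | h
    · have := Submodule.inclusion_injective D.sobolevZero_le (h.trans (map_zero _).symm)
      exact Subtype.ext this
    · exact absurd (norm_sq_le_of_mem_spectralSubspace f.2) (not_le.2 h)

end IFSFamily

/-! ### Weak convergence and self-similarity of the Cantor measures -/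

namespace VTree

variable {J : Type*} {D : IFSFamily J} {V : ℕ}

theorem integrable_of_continuous {f : D.X → ℝ} (hf : Continuous f) (μ : Measure D.X)
    [IsFiniteMeasure μ] : Integrable f μ :=
  hf.integrable_of_hasCompactSupport (HasCompactSupport.of_compactSpace _)

theorem integral_approxMeasure (T : VTree D V) (n : ℕ) {f : D.X → ℝ} (hf : Continuous f) :
    ∫ x, f x ∂(T.approxMeasure n : Measure D.X) =
      ∑ w ∈ generation n T, w.mass * ∫ x, f (w.map x) ∂D.uniform := by
  have h : (T.approxMeasure n : Measure D.X) =
    ∑ w ∈ generation n T, ENNReal.ofReal w.mass • D.uniform.map w.map := rfl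
  have hp : ∀ w : Node T, IsProbabilityMeasure (D.uniform.map w.map) := fun w =>
    Measure.isProbabilityMeasure_map w.measurable_map.aemeasurable
  rw [h, integral_finsetSum_measure fun w _ =>
    (integrable_of_continuous hf _).smul_measure ENNReal.ofReal_ne_top]
  refine Finset.sum_congr rfl fun w _ => ?_
  rw [integral_smul_measure, ENNReal.toReal_ofReal w.mass_pos.le, smul_eq_mul,
    integral_map w.measurable_map.aemeasurable hf.aestronglyMeasurable]

theorem continuous_S (j : J) (i : Fin (D.N j)) : Continuous (D.S j i) := by
  unfold IFSFamily.S
  fun_prop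

theorem integral_approxMeasure_succ (T : VTree D V) (n : ℕ) {f : D.X → ℝ} (hf : Continuous f) :
    ∫ x, f x ∂(T.approxMeasure (n + 1) : Measure D.X) =
      ∑ i, D.m T.index i *
        ∫ x, f (D.S T.index i x) ∂((T.child i).approxMeasure n : Measure D.X) := by
  rw [integral_approxMeasure T _ hf, generation, Finset.sum_map, Finset.sum_sigma]
  refine Finset.sum_congr rfl fun i _ => ?_
  rw [integral_approxMeasure _ _ (f := fun x => f (D.S T.index i x))
    (hf.comp (continuous_S _ _)), Finset.mul_sum]
  refine Finset.sum_congr rfl fun w _ => ?_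
  rw [← mul_assoc]
  rfl

theorem dist_S (j : J) (i : Fin (D.N j)) (x y : D.X) :
    dist (D.S j i x) (D.S j i y) = D.r j i * dist x y := by
  simp only [Subtype.dist_eq, IFSFamily.S, dist_add_right, Real.dist_eq, ← mul_sub, abs_mul,
    abs_of_pos (D.r_pos j i)]

theorem abs_integral_sub_le {f : D.X → ℝ} {L : ℝ} (hL : 0 ≤ L)
    (hf : ∀ x y, |f x - f y| ≤ L * dist x y) (hfc : Continuous f) (μ : ProbabilityMeasure D.X) :
    |∫ x, f x ∂(μ : Measure D.X) - f D.left| ≤ L * (D.b - D.a) := by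
  have h : ∫ x, f x ∂(μ : Measure D.X) - f D.left =
      ∫ x, (f x - f D.left) ∂(μ : Measure D.X) := by
    rw [integral_sub (integrable_of_continuous hfc _) (integrable_const _)]
    simp
  rw [h, ← Real.norm_eq_abs]
  refine (norm_integral_le_of_norm_le_const (C := L * (D.b - D.a))
    (Eventually.of_forall fun x => ?_)).trans_eq (by simp)
  refine (hf _ _).trans (mul_le_mul_of_nonneg_left ?_ hL)
  rw [Subtype.dist_eq, Real.dist_eq]
  change |(x : ℝ) - D.a| ≤ _
  rw [abs_of_nonneg (sub_nonneg.2 x.2.1)]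
  exact sub_le_sub_right x.2.2 _

/-- Passing to the children composes f with contractions, which multiplies the Lipschitz constant by
β, while the weights sum to one. In generation 0 both integrals lie within L (b − a) of f(a), whence
the factor 2. -/
theorem abs_integral_approxMeasure_sub_le {β : ℝ} (hβ : ∀ j i, D.r j i ≤ β) (n : ℕ) :
    ∀ (T : VTree D V) {f : D.X → ℝ} {L : ℝ}, 0 ≤ L → (∀ x y, |f x - f y| ≤ L * dist x y) →
      Continuous f →
      |∫ x, f x ∂(T.approxMeasure n : Measure D.X) -
        ∫ x, f x ∂(T.approxMeasure (n + 1) : Measure D.X)| ≤ 2 * L * (D.b - D.a) * β ^ n := by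
  induction n with
  | zero =>
    intro T f L hL hf hfc
    have h1 := abs_integral_sub_le hL hf hfc (T.approxMeasure 0)
    have h2 := abs_integral_sub_le hL hf hfc (T.approxMeasure (0 + 1))
    rw [abs_le] at *
    constructor <;> linarith
  | succ n ih =>
    intro T f L hL hf hfc
    rw [integral_approxMeasure_succ T n hfc, integral_approxMeasure_succ T (n + 1) hfc,
      ← Finset.sum_sub_distrib]
    refine (Finset.abs_sum_le_sum_abs _ _).trans ?_
    have hβ0 : 0 ≤ β := (D.r_pos T.index ⟨0, by have := D.two_le_N T.index; omega⟩).le.trans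
      (hβ _ _)
    have h : ∀ i ∈ Finset.univ, |D.m T.index i *
          ∫ x, f (D.S T.index i x) ∂((T.child i).approxMeasure n : Measure D.X) -
        D.m T.index i *
          ∫ x, f (D.S T.index i x) ∂((T.child i).approxMeasure (n + 1) : Measure D.X)| ≤
        D.m T.index i * (2 * L * (D.b - D.a) * β ^ (n + 1)) := fun i _ => by
      rw [← mul_sub, abs_mul, abs_of_pos (D.m_pos _ _)]
      refine mul_le_mul_of_nonneg_left ?_ (D.m_pos _ _).le
      refine (ih (T.child i) (f := fun x => f (D.S T.index i x)) (L := L * β)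
        (mul_nonneg hL hβ0) (fun x y => ?_) (hfc.comp (continuous_S _ _))).trans_eq (by ring)
      refine (hf _ _).trans ?_
      rw [dist_S, mul_assoc]
      exact mul_le_mul_of_nonneg_left (mul_le_mul_of_nonneg_right (hβ _ _) dist_nonneg) hL
    refine (Finset.sum_le_sum h).trans_eq ?_
    rw [← Finset.sum_mul, D.m_sum, one_mul]

/-- The approximating measures converge weakly. -/
theorem tendsto_approxMeasure {β : ℝ} (hβ1 : β < 1) (hβ : ∀ j i, D.r j i ≤ β) (T : VTree D V) :
    Tendsto T.approxMeasure atTop (𝓝 T.cantorMeasure) := by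
  have : Nonempty (ProbabilityMeasure D.X) := ⟨T.approxMeasure 0⟩
  -- Compactness supplies a candidate limit. Integrals of Lipschitz functions form Cauchy sequences,
  -- so they converge to the integral against this cluster point; only then does `limUnder` denote a
  -- genuine limit.
  obtain ⟨μ, hμ⟩ := exists_clusterPt_of_compactSpace (map T.approxMeasure atTop)
  have h : Tendsto T.approxMeasure atTop (𝓝 μ) := by
    rw [tendsto_iff_forall_lipschitz_integral_tendsto]
    rintro f ⟨C, hC⟩ ⟨L, hL⟩
    have hc : CauchySeq fun n => ∫ x, f x ∂(T.approxMeasure n : Measure D.X) :=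
      cauchySeq_of_le_geometric β (2 * L * (D.b - D.a)) hβ1 fun n => by
        rw [Real.dist_eq]
        exact abs_integral_approxMeasure_sub_le hβ n T L.2
          (fun x y => by simpa [Real.dist_eq] using hL.dist_le_mul x y) hL.continuous
    obtain ⟨c, hc⟩ := cauchySeq_tendsto_of_complete hc
    have hcont : Continuous fun ν : ProbabilityMeasure D.X => ∫ x, f x ∂(ν : Measure D.X) :=
      ProbabilityMeasure.continuous_integral_boundedContinuousFunction
        (BoundedContinuousFunction.mkOfCompact ⟨f, hL.continuous⟩)
    have h1 : MapClusterPt (∫ x, f x ∂(μ : Measure D.X)) atTop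
        fun n => ∫ x, f x ∂(T.approxMeasure n : Measure D.X) :=
      MapClusterPt.continuousAt_comp hcont.continuousAt hμ
    have h2 : c = ∫ x, f x ∂(μ : Measure D.X) := by
      by_contra hne
      exact (disjoint_nhds_nhds.2 hne).symm.mono_right hc |>.eq_bot ▸ h1.neBot |>.ne rfl
    exact h2 ▸ hc
  have h3 : T.cantorMeasure = μ := h.limUnder_eq
  rw [h3]
  exact h

/-- The self-similarity of the Cantor measures. -/
theorem integral_cantorMeasure {β : ℝ} (hβ1 : β < 1) (hβ : ∀ j i, D.r j i ≤ β) (T : VTree D V)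
    {f : D.X → ℝ} (hf : Continuous f) :
    ∫ x, f x ∂(T.cantorMeasure : Measure D.X) =
      ∑ i, D.m T.index i *
        ∫ x, f (D.S T.index i x) ∂((T.child i).cantorMeasure : Measure D.X) := by
  have hlim : ∀ (T : VTree D V) {g : D.X → ℝ}, Continuous g →
      Tendsto (fun n => ∫ x, g x ∂(T.approxMeasure n : Measure D.X)) atTop
        (𝓝 (∫ x, g x ∂(T.cantorMeasure : Measure D.X))) := fun T g hg =>
    ProbabilityMeasure.tendsto_iff_forall_integral_tendsto.1 (tendsto_approxMeasure hβ1 hβ T)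
      (BoundedContinuousFunction.mkOfCompact ⟨g, hg⟩)
  refine tendsto_nhds_unique ((tendsto_add_atTop_iff_nat 1).2 (hlim T hf)) ?_
  simp only [integral_approxMeasure_succ T _ hf]
  exact tendsto_finsetSum _ fun i _ =>
    (hlim (T.child i) (hf.comp (continuous_S _ _))).const_mul _

end VTree

/-! ### Scaling of energies under the contractions -/

theorem MeasureTheory.IntegrableOn.comp_mul_add {u : ℝ → ℝ} {r c p q : ℝ} (hr : 0 < r)
    (hpq : p ≤ q) (h : IntegrableOn u (Icc (r * p + c) (r * q + c))) :
    IntegrableOn (fun t => u (r * t + c)) (Icc p q) := by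
  have hle : r * p + c ≤ r * q + c := by
    have := mul_le_mul_of_nonneg_left hpq hr.le
    linarith
  rw [← intervalIntegrable_iff_integrableOn_Icc_of_le hle] at h
  rw [← intervalIntegrable_iff_integrableOn_Icc_of_le hpq]
  have h1 := (h.comp_add_right c).comp_mul_left (c := r)
  simpa [mul_div_cancel_left₀ _ hr.ne'] using h1

theorem MeasureTheory.MemLp.comp_mul_add {u : ℝ → ℝ} {r c p q : ℝ} (hr : 0 < r) (hpq : p ≤ q)
    (h : MemLp u 2 (volume.restrict (Icc (r * p + c) (r * q + c)))) :
    MemLp (fun t => u (r * t + c)) 2 (volume.restrict (Icc p q)) := by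
  have h1 : IntegrableOn u (Icc (r * p + c) (r * q + c)) := h.integrable (by norm_num)
  have h2 := h1.comp_mul_add hr hpq
  rw [memLp_two_iff_integrable_sq h2.aestronglyMeasurable]
  exact MeasureTheory.IntegrableOn.comp_mul_add (u := fun t => u t ^ 2) hr hpq
    ((memLp_two_iff_integrable_sq h.1).1 h)

namespace IFSFamily

variable {J : Type*} {D : IFSFamily J} {j : J}

theorem image_le_image {i i' : Fin (D.N j)} (h : i < i') :
    D.r j i * D.b + D.c j i ≤ D.r j i' * D.a + D.c j i' := by
  obtain ⟨n, hn⟩ : ∃ n, (i : ℕ) + n + 1 = i' := ⟨i' - i - 1, by have : (i : ℕ) < i' := h; omega⟩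
  induction n generalizing i' with
  | zero => exact D.ordered j i i' hn
  | succ n ih =>
    have hlt : (i : ℕ) + n + 1 < D.N j := by have := i'.2; omega
    refine (ih (i' := ⟨(i : ℕ) + n + 1, hlt⟩) (by change (i : ℕ) < _; simp only; omega) rfl).trans ?_
    exact (D.lt_image j _).le.trans (D.ordered j _ i' (by simp only; omega))

theorem le_S_left (i : Fin (D.N j)) : D.a ≤ D.r j i * D.a + D.c j i := (D.S j i D.left).2.1

theorem S_right_le (i : Fin (D.N j)) : D.r j i * D.b + D.c j i ≤ D.b := (D.S j i D.right).2.2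

theorem pairwise_disjoint_image :
    Pairwise (Function.onFun Disjoint fun i : Fin (D.N j) =>
      Ioc (D.r j i * D.a + D.c j i) (D.r j i * D.b + D.c j i)) := by
  intro i i' hne
  rw [Function.onFun, Set.disjoint_left]
  intro t ht ht'
  rcases lt_or_gt_of_ne hne with h | h
  · exact absurd (ht'.1.trans_le ht.2) (not_lt.2 (image_le_image h))
  · exact absurd (ht.1.trans_le ht'.2) (not_lt.2 (image_le_image h))

theorem IsWeakDeriv.comp_S {f : D.X → ℝ} {u : ℝ → ℝ} (h : D.IsWeakDeriv f u)
    (i : Fin (D.N j)) :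
    D.IsWeakDeriv (f ∘ D.S j i) fun t => D.r j i * u (D.r j i * t + D.c j i) := by
  refine ⟨MemLp.const_mul (MemLp.comp_mul_add (D.r_pos j i) D.a_lt_b.le ?_) _, fun x => ?_⟩
  · exact h.1.mono_measure (Measure.restrict_mono
      (Icc_subset_Icc (le_S_left i) (S_right_le i)) le_rfl)
  · have h1 := h.2 (D.S j i x)
    have h2 := h.2 (D.S j i D.left)
    rw [intervalIntegral.integral_const_mul, intervalIntegral.integral_comp_mul_add _
      (D.r_pos j i).ne', smul_eq_mul, mul_inv_cancel_left₀ (D.r_pos j i).ne']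
    rw [Function.comp_apply, Function.comp_apply, h1, h2, add_assoc]
    congr 1
    exact (intervalIntegral.integral_add_adjacent_intervals
      (h.intervalIntegrable (D.S j i D.left))
      ((h.intervalIntegrable (D.S j i D.left)).symm.trans (h.intervalIntegrable _))).symm

theorem integral_sq_comp_S {u : ℝ → ℝ} (i : Fin (D.N j)) :
    (D.r j i)⁻¹ * ∫ t in D.a..D.b, (D.r j i * u (D.r j i * t + D.c j i)) ^ 2 =
      ∫ t in Ioc (D.r j i * D.a + D.c j i) (D.r j i * D.b + D.c j i), u t ^ 2 := by
  have hr := (D.r_pos j i).ne'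
  simp only [mul_pow]
  rw [intervalIntegral.integral_const_mul, intervalIntegral.integral_comp_mul_add
    (fun t => u t ^ 2) hr, intervalIntegral.integral_of_le (D.lt_image j i).le, smul_eq_mul]
  field_simp

/-- The energies on the images of `[a, b]` add up to at most the energy on `[a, b]`. -/
theorem sum_integral_sq_comp_S_le {f : D.X → ℝ} {u : ℝ → ℝ} (h : D.IsWeakDeriv f u) :
    ∑ i, (D.r j i)⁻¹ * ∫ t in D.a..D.b, (D.r j i * u (D.r j i * t + D.c j i)) ^ 2 ≤
      ∫ t in D.a..D.b, u t ^ 2 := by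
  simp only [integral_sq_comp_S]
  have hint : IntegrableOn (fun t => u t ^ 2) (Ioc D.a D.b) :=
    IntegrableOn.mono_set ((memLp_two_iff_integrable_sq h.1.1).1 h.1) Ioc_subset_Icc_self
  have hsub : ∀ i : Fin (D.N j), Ioc (D.r j i * D.a + D.c j i) (D.r j i * D.b + D.c j i) ⊆
      Ioc D.a D.b := fun i => Ioc_subset_Ioc (le_S_left i) (S_right_le i)
  rw [← integral_biUnion_finset Finset.univ (fun i _ => measurableSet_Ioc)
    (fun i _ i' _ hne => pairwise_disjoint_image hne) (fun i _ => hint.mono_set (hsub i)),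
    intervalIntegral.integral_of_le D.a_lt_b.le]
  -- The energy on the gaps between the images is discarded here.
  exact setIntegral_mono_set hint (Eventually.of_forall fun t => sq_nonneg _)
    (LE.le.eventuallyLE (iUnion₂_subset fun i _ => hsub i))

/-- The inverse of `S`, extended to `[a, b]` by constants. -/
noncomputable def clampInv (j : J) (i : Fin (D.N j)) (y : D.X) : D.X :=
  projIcc D.a D.b D.a_lt_b.le ((D.r j i)⁻¹ * y + -((D.r j i)⁻¹ * D.c j i))

theorem inv_mul_add_neg (i : Fin (D.N j)) (y : ℝ) :
    (D.r j i)⁻¹ * y + -((D.r j i)⁻¹ * D.c j i) = (y - D.c j i) / D.r j i := by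
  have hr := (D.r_pos j i).ne'
  field_simp
  ring

theorem clampInv_of_le (i : Fin (D.N j)) {y : D.X} (h : (y : ℝ) ≤ D.r j i * D.a + D.c j i) :
    D.clampInv j i y = D.left := by
  refine projIcc_of_le_left _ ?_
  rw [inv_mul_add_neg, div_le_iff₀ (D.r_pos j i)]
  linarith

theorem clampInv_of_ge (i : Fin (D.N j)) {y : D.X} (h : D.r j i * D.b + D.c j i ≤ (y : ℝ)) :
    D.clampInv j i y = D.right := by
  refine projIcc_of_right_le _ ?_
  rw [inv_mul_add_neg, le_div_iff₀ (D.r_pos j i)]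
  linarith

theorem clampInv_S (i : Fin (D.N j)) (x : D.X) : D.clampInv j i (D.S j i x) = x := by
  have : (D.r j i)⁻¹ * (D.S j i x : ℝ) + -((D.r j i)⁻¹ * D.c j i) = x := by
    have hr := (D.r_pos j i).ne'
    rw [inv_mul_add_neg]
    simp only [S]
    field_simp
    ring
  rw [clampInv, this, projIcc_val]

theorem clampInv_left (i : Fin (D.N j)) : D.clampInv j i D.left = D.left :=
  clampInv_of_le i (le_S_left i)

theorem clampInv_right (i : Fin (D.N j)) : D.clampInv j i D.right = D.right :=
  clampInv_of_ge i (S_right_le i)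

/-- Identifies the part of (a, y] that contributes to the primitive of `clampDeriv`, uniformly in
the position of y to the left of, inside or to the right of the image. -/
theorem Ioc_inter_image (i : Fin (D.N j)) (y : D.X) :
    Ioc D.a (y : ℝ) ∩ Ioc (D.r j i * D.a + D.c j i) (D.r j i * D.b + D.c j i) =
      Ioc (D.r j i * D.a + D.c j i) (D.S j i (D.clampInv j i y)) := by
  have h1 := le_S_left (D := D) i
  have h2 := S_right_le (D := D) i
  rw [Ioc_inter_Ioc, max_eq_right h1]
  rcases le_total (y : ℝ) (D.r j i * D.a + D.c j i) with h | h
  · rw [clampInv_of_le i h, Ioc_eq_empty, Ioc_eq_empty]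
    · simp [S, left]
    · simp [h]
  · rcases le_total (D.r j i * D.b + D.c j i) (y : ℝ) with h' | h'
    · rw [clampInv_of_ge i h', min_eq_right h']
      rfl
    · have hr := D.r_pos j i
      have hm : ((y : ℝ) - D.c j i) / D.r j i ∈ Icc D.a D.b := by
        rw [mem_Icc, le_div_iff₀ hr, div_le_iff₀ hr]
        constructor <;> linarith
      have : y = D.S j i ⟨_, hm⟩ := by
        ext
        simp only [S]
        field_simp
        ring
      rw [min_eq_left h']
      conv_rhs => rw [this, clampInv_S, ← this]

/-- The weak derivative of `f ∘ clampInv`. -/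
noncomputable def clampDeriv (j : J) (i : Fin (D.N j)) (u : ℝ → ℝ) : ℝ → ℝ :=
  (Ioc (D.r j i * D.a + D.c j i) (D.r j i * D.b + D.c j i)).indicator
    fun t => (D.r j i)⁻¹ * u ((D.r j i)⁻¹ * t + -((D.r j i)⁻¹ * D.c j i))

theorem inv_mul_S (i : Fin (D.N j)) (y : ℝ) :
    (D.r j i)⁻¹ * (D.r j i * y + D.c j i) + -((D.r j i)⁻¹ * D.c j i) = y := by
  have hr := (D.r_pos j i).ne'
  field_simp
  ring

theorem IsWeakDeriv.comp_clampInv {f : D.X → ℝ} {u : ℝ → ℝ} (h : D.IsWeakDeriv f u)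
    (i : Fin (D.N j)) : D.IsWeakDeriv (f ∘ D.clampInv j i) (D.clampDeriv j i u) := by
  refine ⟨?_, fun y => ?_⟩
  · rw [clampDeriv, memLp_indicator_iff_restrict measurableSet_Ioc]
    have h1 : MemLp (fun t => (D.r j i)⁻¹ * u ((D.r j i)⁻¹ * t + -((D.r j i)⁻¹ * D.c j i))) 2
        (volume.restrict (Icc (D.r j i * D.a + D.c j i) (D.r j i * D.b + D.c j i))) := by
      refine MemLp.const_mul (MemLp.comp_mul_add (inv_pos.2 (D.r_pos j i))
        (D.lt_image j i).le ?_) _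
      rw [inv_mul_S, inv_mul_S]
      exact h.1
    refine h1.mono_measure ?_
    rw [Measure.restrict_restrict measurableSet_Ioc]
    exact Measure.restrict_mono (inter_subset_left.trans Ioc_subset_Icc_self) le_rfl
  · rw [Function.comp_apply, Function.comp_apply, clampInv_left, h.2 (D.clampInv j i y)]
    congr 1
    rw [intervalIntegral.integral_of_le y.2.1, clampDeriv, setIntegral_indicator measurableSet_Ioc,
      Ioc_inter_image, ← intervalIntegral.integral_of_le, intervalIntegral.integral_const_mul,
      intervalIntegral.integral_comp_mul_add _ (inv_pos.2 (D.r_pos j i)).ne', inv_mul_S]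
    · simp only [S]
      rw [inv_mul_S, smul_eq_mul, inv_inv, inv_mul_cancel_left₀ (D.r_pos j i).ne']
    · have := mul_le_mul_of_nonneg_left (D.clampInv j i y).2.1 (D.r_pos j i).le
      simp only [S]
      linarith

/-- The squared derivative contributes r⁻² and the change of variables r. -/
theorem integral_sq_clampDeriv (i : Fin (D.N j)) (u : ℝ → ℝ) :
    ∫ t in D.a..D.b, D.clampDeriv j i u t ^ 2 = (D.r j i)⁻¹ * ∫ t in D.a..D.b, u t ^ 2 := by
  have hr := (D.r_pos j i).ne'
  have h : (fun t => D.clampDeriv j i u t ^ 2) =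
      (Ioc (D.r j i * D.a + D.c j i) (D.r j i * D.b + D.c j i)).indicator
        fun t => (D.r j i)⁻¹ ^ 2 * u ((D.r j i)⁻¹ * t + -((D.r j i)⁻¹ * D.c j i)) ^ 2 := by
    ext t
    simp only [clampDeriv, indicator_apply]
    split_ifs <;> simp [mul_pow]
  rw [h, intervalIntegral.integral_of_le D.a_lt_b.le, setIntegral_indicator measurableSet_Ioc,
    inter_eq_right.2 (Ioc_subset_Ioc (le_S_left i) (S_right_le i)),
    ← intervalIntegral.integral_of_le (D.lt_image j i).le, intervalIntegral.integral_const_mul,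
    intervalIntegral.integral_comp_mul_add (fun t => u t ^ 2) (inv_ne_zero hr), inv_mul_S,
    inv_mul_S, smul_eq_mul]
  field_simp

/-- At most one summand is nonzero at t; the half-open intervals are disjoint even when neighbouring
images touch. -/
theorem sum_clampDeriv_sq (u : Fin (D.N j) → ℝ → ℝ) (t : ℝ) :
    (∑ i, D.clampDeriv j i (u i) t) ^ 2 = ∑ i, D.clampDeriv j i (u i) t ^ 2 := by
  by_cases h : ∃ i : Fin (D.N j),
    t ∈ Ioc (D.r j i * D.a + D.c j i) (D.r j i * D.b + D.c j i)
  · obtain ⟨i, hi⟩ := h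
    have h0 : ∀ i', i' ≠ i → D.clampDeriv j i' (u i') t = 0 := fun i' hne =>
      indicator_of_notMem (fun h' => Set.disjoint_left.1 (pairwise_disjoint_image hne) h' hi) _
    rw [Finset.sum_eq_single i (fun i' _ => h0 i') (by simp),
      Finset.sum_eq_single i (fun i' _ hne => by rw [h0 i' hne]; simp) (by simp)]
  · have h0 : ∀ i, D.clampDeriv j i (u i) t = 0 := fun i =>
      indicator_of_notMem (fun h' => h ⟨i, h'⟩) _
    simp [h0]

theorem IsWeakDeriv.sum {ι : Type*} (s : Finset ι) {f : ι → D.X → ℝ} {u : ι → ℝ → ℝ}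
    (h : ∀ i ∈ s, D.IsWeakDeriv (f i) (u i)) : D.IsWeakDeriv (∑ i ∈ s, f i) (∑ i ∈ s, u i) := by
  classical
  induction s using Finset.induction_on with
  | empty => simpa using isWeakDeriv_zero
  | insert i s hi ih =>
    rw [Finset.sum_insert hi, Finset.sum_insert hi]
    exact (h i (by simp)).add (ih fun i' hi' => h i' (by simp [hi']))

theorem integral_sq_sum_clampDeriv {f : Fin (D.N j) → D.X → ℝ} {u : Fin (D.N j) → ℝ → ℝ}
    (h : ∀ i, D.IsWeakDeriv (f i) (u i)) :
    ∫ t in D.a..D.b, (∑ i, D.clampDeriv j i (u i)) t ^ 2 =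
      ∑ i, (D.r j i)⁻¹ * ∫ t in D.a..D.b, u i t ^ 2 := by
  simp only [Finset.sum_apply, sum_clampDeriv_sq]
  rw [intervalIntegral.integral_finsetSum]
  · simp only [integral_sq_clampDeriv]
  · intro i _
    have := ((h i).comp_clampInv i).intervalIntegrable_mul ((h i).comp_clampInv i)
    simpa only [sq] using this

end IFSFamily

/-! ### Bracketing over one generation -/

theorem toENat_rank_pi {ι : Type} [Fintype ι] {N : ι → Type} [∀ i, AddCommGroup (N i)]
    [∀ i, Module ℝ (N i)] : Cardinal.toENat (Module.rank ℝ ((i : ι) → N i)) =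
      ∑ i, Cardinal.toENat (Module.rank ℝ (N i)) := by
  rw [rank_pi, Cardinal.toENat_sum_eq_tsum, tsum_fintype]

namespace IFSFamily

variable {J : Type*} {D : IFSFamily J} {j : J}

variable (D) in
/-- Restriction of a function to one of the images of `[a, b]`. -/
def pullback (j : J) (i : Fin (D.N j)) : D.sobolev →ₗ[ℝ] D.sobolev :=
  (LinearMap.funLeft ℝ ℝ (D.S j i)).restrict fun _ ⟨_, hu⟩ => ⟨_, hu.comp_S i⟩

variable (D) in
/-- Functions on the images of `[a, b]` that vanish at the end points, put together. -/
noncomputable def glue (j : J) : (Fin (D.N j) → D.sobolevZero) →ₗ[ℝ] D.sobolevZero :=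
  LinearMap.codRestrict D.sobolevZero
    (∑ i, LinearMap.funLeft ℝ ℝ (D.clampInv j i) ∘ₗ D.sobolevZero.subtype ∘ₗ LinearMap.proj i)
    fun f => by
      rw [LinearMap.sum_apply]
      refine Submodule.sum_mem _ fun i _ => ?_
      obtain ⟨⟨u, hu⟩, h1, h2⟩ := (f i).2
      refine ⟨⟨_, hu.comp_clampInv i⟩, ?_, ?_⟩
      · change (f i : D.X → ℝ) (D.clampInv j i D.left) = 0
        rw [clampInv_left, h1]
      · change (f i : D.X → ℝ) (D.clampInv j i D.right) = 0
        rw [clampInv_right, h2]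

theorem glue_apply (f : Fin (D.N j) → D.sobolevZero) :
    (D.glue j f : D.X → ℝ) = ∑ i, (f i : D.X → ℝ) ∘ D.clampInv j i := by
  change (∑ i, LinearMap.funLeft ℝ ℝ (D.clampInv j i) ∘ₗ D.sobolevZero.subtype ∘ₗ
    LinearMap.proj i : (Fin (D.N j) → D.sobolevZero) →ₗ[ℝ] (D.X → ℝ)) f = _
  rw [LinearMap.sum_apply]
  rfl

/-- On the i-th image every other summand is constant, equal to the value of its function at an end
point, which is zero. -/
theorem glue_S (f : Fin (D.N j) → D.sobolevZero) (i : Fin (D.N j)) (x : D.X) :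
    (D.glue j f : D.X → ℝ) (D.S j i x) = (f i : D.X → ℝ) x := by
  rw [glue_apply, Finset.sum_apply, Finset.sum_eq_single i]
  · rw [Function.comp_apply, clampInv_S]
  · intro i' _ hne
    have h1 := mul_le_mul_of_nonneg_left x.2.1 (D.r_pos j i).le
    have h2 := mul_le_mul_of_nonneg_left x.2.2 (D.r_pos j i).le
    rcases lt_or_gt_of_ne hne with h | h
    · rw [Function.comp_apply, clampInv_of_ge, (f i').2.2.2]
      have := image_le_image h
      simp only [S]
      linarith
    · rw [Function.comp_apply, clampInv_of_le, (f i').2.2.1]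
      have := image_le_image h
      simp only [S]
      linarith
  · simp

variable {μ : ProbabilityMeasure D.X} {ν : Fin (D.N j) → ProbabilityMeasure D.X}

/-- Dirichlet bracketing for a self-similar decomposition of a measure. -/
theorem sum_eigenvalueCount_sobolevZero_le
    (hμ : ∀ f : D.X → ℝ, Continuous f → ∫ x, f x ∂(μ : Measure D.X) =
      ∑ i, D.m j i * ∫ x, f (D.S j i x) ∂(ν i : Measure D.X)) {x : ℝ} (hx : 0 ≤ x) :
    ∑ i, D.eigenvalueCount D.sobolevZero (ν i) (D.r j i * D.m j i * x) ≤
      D.eigenvalueCount D.sobolevZero μ x := by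
  simp only [D.eigenvalueCount_eq D.sobolevZero_le]
  let W : (i : Fin (D.N j)) → Submodule ℝ D.sobolevZero := fun i =>
    spectralSubspace (D.derivOn D.sobolevZero_le) (D.toL2On D.sobolevZero_le (ν i))
      (D.r j i * D.m j i * x)
  have h := toENat_rank_le_sum_spectralSubspace (ι := Unit) (M := (i : Fin (D.N j)) → W i)
    (fun _ => D.isSpectral_sobolevZero μ)
    (fun _ => D.glue j ∘ₗ LinearMap.pi fun i => (W i).subtype ∘ₗ LinearMap.proj i)
    (fun _ => x) (fun _ => hx) ?_
  · rw [toENat_rank_pi] at h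
    simpa using h
  · intro f hf
    set g : Fin (D.N j) → D.sobolevZero := fun i => (f i : D.sobolevZero) with hg
    have hf' := hf ()
    change D.glue j g = 0 ∨ x * ‖D.toL2On D.sobolevZero_le μ (D.glue j g)‖ ^ 2 <
      ‖D.derivOn D.sobolevZero_le (D.glue j g)‖ ^ 2 at hf'
    rcases hf' with h | h
    -- The glued function determines its pieces, so it vanishes only if all of them do.
    · ext i y
      have := glue_S g i y
      rw [h] at this
      exact this.symm
    · exfalso
      refine absurd h (not_lt.2 ?_)
      choose u hu using fun i => (g i).2.1
      have h1 : D.IsWeakDeriv (Submodule.inclusion D.sobolevZero_le (D.glue j g) : D.X → ℝ)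
          (∑ i, D.clampDeriv j i (u i)) := by
        change D.IsWeakDeriv (D.glue j g : D.X → ℝ) _
        rw [glue_apply]
        exact IsWeakDeriv.sum _ fun i _ => (hu i).comp_clampInv i
      have h2 : Continuous (D.glue j g : D.X → ℝ) := h1.continuous
      -- Energy and L² norm of the glued function split over the images with factors r⁻¹ and m. The
      -- bound on each piece by r m x therefore adds up to the bound by x.
      rw [derivOn, LinearMap.comp_apply, D.norm_sq_weakDeriv h1, integral_sq_sum_clampDeriv hu,
        toL2On, LinearMap.comp_apply, norm_sq_toL2, Submodule.coe_inclusion,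
        hμ (fun y => (D.glue j g : D.X → ℝ) y ^ 2) (h2.pow 2), Finset.mul_sum]
      refine Finset.sum_le_sum fun i _ => ?_
      simp only [glue_S]
      have h3 := norm_sq_le_of_mem_spectralSubspace (f i).2
      have h4 : D.IsWeakDeriv (Submodule.inclusion D.sobolevZero_le (g i) : D.X → ℝ) (u i) := hu i
      rw [derivOn, LinearMap.comp_apply, D.norm_sq_weakDeriv h4, toL2On, LinearMap.comp_apply,
        norm_sq_toL2, Submodule.coe_inclusion] at h3
      rw [inv_mul_le_iff₀ (D.r_pos j i)]
      refine h3.trans_eq ?_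
      ring

/-- Neumann bracketing for a self-similar decomposition of a measure. -/
theorem eigenvalueCount_sobolev_le_sum
    (hμ : ∀ f : D.X → ℝ, Continuous f → ∫ x, f x ∂(μ : Measure D.X) =
      ∑ i, D.m j i * ∫ x, f (D.S j i x) ∂(ν i : Measure D.X)) {x : ℝ} (hx : 0 ≤ x) :
    D.eigenvalueCount D.sobolev μ x ≤
      ∑ i, D.eigenvalueCount D.sobolev (ν i) (D.r j i * D.m j i * x) := by
  simp only [D.eigenvalueCount_eq le_rfl]
  refine toENat_rank_le_sum_spectralSubspace
    (M := spectralSubspace (D.derivOn le_rfl) (D.toL2On (F := D.sobolev) le_rfl μ) x)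
    (fun i => D.isSpectral_sobolev (ν i)) (fun i => (D.pullback j i).domRestrict _) _
    (fun i => by have := D.r_pos j i; have := D.m_pos j i; positivity) fun f hf => ?_
  have hf1 := norm_sq_le_of_mem_spectralSubspace f.2
  obtain ⟨u, hu⟩ := (f : D.sobolev).2
  have hu' : ∀ i, D.IsWeakDeriv (D.pullback j i f : D.X → ℝ) _ := fun i => hu.comp_S i
  have hnorm : ∀ ν' : ProbabilityMeasure D.X, ∀ g : D.sobolev,
      ‖D.toL2On le_rfl ν' g‖ ^ 2 = ∫ x, (g : D.X → ℝ) x ^ 2 ∂(ν' : Measure D.X) :=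
    fun ν' g => D.norm_sq_toL2 ν' g
  have hder : ∀ (g : D.sobolev) v, D.IsWeakDeriv g v →
      ‖D.derivOn le_rfl g‖ ^ 2 = ∫ t in D.a..D.b, v t ^ 2 := fun g v hv => D.norm_sq_weakDeriv hv
  have hmass : ‖D.toL2On le_rfl μ (f : D.sobolev)‖ ^ 2 =
      ∑ i, D.m j i * ‖D.toL2On le_rfl (ν i) (D.pullback j i f)‖ ^ 2 := by
    simp only [hnorm]
    rw [hμ (fun y => (f : D.sobolev).1 y ^ 2) (hu.continuous.pow 2)]
    rfl
  have hen : ∑ i, (D.r j i)⁻¹ * ‖D.derivOn le_rfl (D.pullback j i f)‖ ^ 2 ≤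
      ‖D.derivOn le_rfl (f : D.sobolev)‖ ^ 2 := by
    rw [hder _ _ hu]
    simp only [fun i => hder _ _ (hu' i)]
    exact sum_integral_sq_comp_S_le hu
  have hi : ∀ i, D.pullback j i f = 0 ∨ D.r j i * D.m j i * x *
      ‖D.toL2On le_rfl (ν i) (D.pullback j i f)‖ ^ 2 <
        ‖D.derivOn le_rfl (D.pullback j i f)‖ ^ 2 := hf
  have hle : ∀ i ∈ Finset.univ,
      x * (D.m j i * ‖D.toL2On le_rfl (ν i) (D.pullback j i f)‖ ^ 2) ≤
        (D.r j i)⁻¹ * ‖D.derivOn le_rfl (D.pullback j i f)‖ ^ 2 := fun i _ => by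
    rw [le_inv_mul_iff₀ (D.r_pos j i)]
    rcases hi i with h | h
    · simp [h]
    · refine le_trans (le_of_eq (by ring)) h.le
  have hsum := (hmass ▸ hf1).trans' hen
  rw [Finset.mul_sum] at hsum
  -- The chain x‖f‖² = ∑ x m ‖f ∘ S_i‖² ≤ ∑ r⁻¹ 𝓔(f ∘ S_i) ≤ 𝓔(f) ≤ x‖f‖² forces equality in every
  -- summand. This contradicts the strict alternative, so all restrictions vanish; then f is zero in
  -- L²(μ) and has no energy.
  have heq := (Finset.sum_eq_sum_iff_of_le hle).1 (le_antisymm (Finset.sum_le_sum hle) hsum)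
  have hzero : ∀ i, D.pullback j i f = 0 := fun i => by
    refine (hi i).resolve_right fun h => ?_
    have h1 := heq i (Finset.mem_univ i)
    rw [eq_inv_mul_iff_mul_eq₀ (D.r_pos j i).ne'] at h1
    refine h.ne (Eq.trans (by ring) h1)
  have h1 : ‖D.toL2On le_rfl μ (f : D.sobolev)‖ ^ 2 = 0 := by
    rw [hmass]
    simp [hzero]
  have h2 : ‖D.derivOn le_rfl (f : D.sobolev)‖ ^ 2 ≤ 0 := by
    rw [h1, mul_zero] at hf1
    exact hf1
  refine Subtype.ext (D.eq_zero_of_derivOn_eq_zero le_rfl μ f ?_ ?_)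
  · exact norm_eq_zero.1 (pow_eq_zero_iff two_ne_zero |>.1 (le_antisymm h2 (sq_nonneg _)))
  · exact norm_eq_zero.1 (pow_eq_zero_iff two_ne_zero |>.1 h1)

end IFSFamily

/-! ### Cuts of the tree and iteration of the one-generation inequalities -/

namespace VTree

variable {J : Type*} {D : IFSFamily J} {V : ℕ}

namespace Node

theorem take_zero : {T : VTree D V} → (w : Node T) → w.take 0 = root
  | _, root => rfl
  | _, cons _ _ => rfl

theorem length_take : {T : VTree D V} → (w : Node T) → (n : ℕ) →
    (w.take n).length = min n w.length
  | _, root, n => by simp [take, length]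
  | _, cons i w, 0 => by simp [take, length]
  | _, cons i w, n + 1 => by simp [take, length, length_take w n]

theorem take_of_length_le : {T : VTree D V} → (w : Node T) → (n : ℕ) → w.length ≤ n →
    w.take n = w
  | _, root, n, _ => rfl
  | _, cons i w, 0, h => by simp [length] at h
  | _, cons i w, n + 1, h => by
    rw [take, take_of_length_le w n (by simpa [length] using h)]

theorem take_take : {T : VTree D V} → (w : Node T) → {p q : ℕ} → p ≤ q →
    (w.take q).take p = w.take p
  | _, root, _, _, _ => rfl
  | _, cons i w, 0, q, _ => by rw [take_zero, take_zero]
  | _, cons i w, p + 1, q + 1, h => by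
    simp only [take, take_take w (Nat.succ_le_succ_iff.1 h)]

theorem ratio_pos : {T : VTree D V} → (w : Node T) → 0 < w.ratio
  | _, root => one_pos
  | T, cons i w => mul_pos (D.r_pos T.index i) w.ratio_pos

theorem weight_le_one (j : J) (i : Fin (D.N j)) : D.m j i ≤ 1 :=
  (Finset.single_le_sum (fun i _ => (D.m_pos j i).le) (Finset.mem_univ i)).trans_eq (D.m_sum j)

theorem mass_mul_ratio_le_one : {T : VTree D V} → (w : Node T) → w.mass * w.ratio ≤ 1
  | _, root => by simp [mass, ratio]
  | T, cons i w => by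
    have h1 := mul_le_one₀ (weight_le_one T.index i) (D.r_pos T.index i).le
      (D.r_lt_one T.index i).le
    have h2 := mul_le_one₀ h1 (mul_pos w.mass_pos w.ratio_pos).le w.mass_mul_ratio_le_one
    exact (by simp only [mass, ratio]; ring : _ = _).trans_le h2

theorem mass_mul_ratio_le_take : {T : VTree D V} → (w : Node T) → (n : ℕ) →
    w.mass * w.ratio ≤ (w.take n).mass * (w.take n).ratio
  | _, root, _ => le_rfl
  | _, cons i w, 0 => by
    rw [take_zero]
    simpa [mass, ratio] using (cons i w).mass_mul_ratio_le_one
  | T, cons i w, n + 1 => by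
    have h := mul_le_mul_of_nonneg_left (w.mass_mul_ratio_le_take n)
      (mul_pos (D.m_pos T.index i) (D.r_pos T.index i)).le
    simp only [take, mass, ratio]
    linarith

theorem mass_mul_ratio_le_pow {β : ℝ} (hβ : ∀ j i, D.r j i ≤ β) : {T : VTree D V} →
    (w : Node T) → w.mass * w.ratio ≤ β ^ w.length
  | _, root => by simp [mass, ratio, length]
  | T, cons i w => by
    have h1 : D.m T.index i * D.r T.index i ≤ β :=
      (mul_le_of_le_one_left (D.r_pos T.index i).le (weight_le_one T.index i)).trans (hβ _ _)
    have h2 := mul_le_mul h1 (w.mass_mul_ratio_le_pow hβ) (mul_pos w.mass_pos w.ratio_pos).le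
      ((mul_pos (D.m_pos T.index i) (D.r_pos T.index i)).le.trans h1)
    simp only [mass, ratio, length, pow_succ']
    refine le_trans (le_of_eq (by ring)) h2

end Node

/-- A set of individuals that contains exactly one ancestor of every individual of
generation `M`. -/
structure IsCut {T : VTree D V} (C : Set (Node T)) (M : ℕ) : Prop where
  eq_of_take_mem : ∀ w ∈ C, ∀ n, w.take n ∈ C → w.take n = w
  exists_take_mem : ∀ w : Node T, w.length = M → ∃ n, w.take n ∈ C

theorem IsCut.eq_singleton_root {T : VTree D V} {C : Set (Node T)} {M : ℕ} (hC : IsCut C M)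
    (h : Node.root ∈ C) : C = {Node.root} := by
  refine eq_singleton_iff_unique_mem.2 ⟨h, fun w hw => ?_⟩
  rw [← hC.eq_of_take_mem w hw 0 (by rwa [Node.take_zero]), Node.take_zero]

theorem IsCut.child {T : VTree D V} {C : Set (Node T)} {M : ℕ} (hC : IsCut C (M + 1))
    (h : Node.root ∉ C) (i : Fin (D.N T.index)) :
    IsCut {w : Node (T.child i) | Node.cons i w ∈ C} M where
  eq_of_take_mem w hw n hn := by
    have := hC.eq_of_take_mem (Node.cons i w) hw (n + 1) hn
    simpa [Node.take] using this
  exists_take_mem w hw := by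
    obtain ⟨n, hn⟩ := hC.exists_take_mem (Node.cons i w) (by simp [Node.length, hw])
    cases n with
    | zero => exact (h hn).elim
    | succ n => exact ⟨n, hn⟩

/-- A set of individuals that does not contain the ancestor is the disjoint union of its parts in
the subtrees of the children. -/
noncomputable def sigmaChildEquiv {T : VTree D V} {C : Set (Node T)} (h : Node.root ∉ C) :
    (Σ i, {w : Node (T.child i) | Node.cons i w ∈ C}) ≃ C :=
  Equiv.ofBijective (fun p => ⟨Node.cons p.1 p.2.1, p.2.2⟩) <| by
    constructor
    · rintro ⟨i, w, hw⟩ ⟨i', w', hw'⟩ heq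
      simp only [Subtype.mk.injEq, Node.cons.injEq] at heq
      obtain ⟨rfl, heq⟩ := heq
      obtain rfl := eq_of_heq heq
      rfl
    · rintro ⟨w, hw⟩
      cases w with
      | root => exact (h hw).elim
      | cons i w => exact ⟨⟨i, w, hw⟩, rfl⟩

theorem tsum_eq_sum_child (N : VTree D V → ℝ → ℕ∞) {T : VTree D V} {C : Set (Node T)}
    (h : Node.root ∉ C) (x : ℝ) :
    ∑' w : C, N w.1.subtree (w.1.ratio * w.1.mass * x) =
      ∑ i, ∑' w : {w : Node (T.child i) | Node.cons i w ∈ C},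
        N w.1.subtree (w.1.ratio * w.1.mass * (D.r T.index i * D.m T.index i * x)) := by
  rw [← (sigmaChildEquiv h).tsum_eq, (ENat.summable' _).tsum_sigma' fun _ => ENat.summable' _,
    tsum_fintype]
  refine Finset.sum_congr rfl fun i _ => tsum_congr fun w => ?_
  change N w.1.subtree (D.r T.index i * w.1.ratio * (D.m T.index i * w.1.mass) * x) = _
  congr 1
  ring

theorem tsum_singleton_root (N : VTree D V → ℝ → ℕ∞) (T : VTree D V) (x : ℝ) :
    ∑' w : ({Node.root} : Set (Node T)), N w.1.subtree (w.1.ratio * w.1.mass * x) = N T x := by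
  rw [tsum_fintype]
  simp [Node.subtree, Node.ratio, Node.mass]

theorem child_arg_nonneg (j : J) (i : Fin (D.N j)) {x : ℝ} (hx : 0 ≤ x) :
    0 ≤ D.r j i * D.m j i * x :=
  mul_nonneg (mul_pos (D.r_pos j i) (D.m_pos j i)).le hx

/-- Induction on the depth M: a cut is either the ancestor alone, or it splits into cuts of depth
one less in the children's subtrees. Products along words absorb the factors r m of the first letter
into the argument. -/
theorem tsum_le_of_isCut {N : VTree D V → ℝ → ℕ∞}
    (hN : ∀ (T : VTree D V) (x : ℝ), 0 ≤ x →
      ∑ i, N (T.child i) (D.r T.index i * D.m T.index i * x) ≤ N T x) {M : ℕ} :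
    ∀ {T : VTree D V} {C : Set (Node T)}, IsCut C M → ∀ {x : ℝ}, 0 ≤ x →
      ∑' w : C, N w.1.subtree (w.1.ratio * w.1.mass * x) ≤ N T x := by
  induction M with
  | zero =>
    intro T C hC x hx
    obtain ⟨n, hn⟩ := hC.exists_take_mem Node.root rfl
    rw [hC.eq_singleton_root hn, tsum_singleton_root]
  | succ M ih =>
    intro T C hC x hx
    by_cases h : Node.root ∈ C
    · rw [hC.eq_singleton_root h, tsum_singleton_root]
    · rw [tsum_eq_sum_child N h]
      exact (Finset.sum_le_sum fun i _ => ih (hC.child h i) (child_arg_nonneg _ i hx)).trans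
        (hN T x hx)

theorem le_tsum_of_isCut {N : VTree D V → ℝ → ℕ∞}
    (hN : ∀ (T : VTree D V) (x : ℝ), 0 ≤ x →
      N T x ≤ ∑ i, N (T.child i) (D.r T.index i * D.m T.index i * x)) {M : ℕ} :
    ∀ {T : VTree D V} {C : Set (Node T)}, IsCut C M → ∀ {x : ℝ}, 0 ≤ x →
      N T x ≤ ∑' w : C, N w.1.subtree (w.1.ratio * w.1.mass * x) := by
  induction M with
  | zero =>
    intro T C hC x hx
    obtain ⟨n, hn⟩ := hC.exists_take_mem Node.root rfl
    rw [hC.eq_singleton_root hn, tsum_singleton_root]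
  | succ M ih =>
    intro T C hC x hx
    by_cases h : Node.root ∈ C
    · rw [hC.eq_singleton_root h, tsum_singleton_root]
    · rw [tsum_eq_sum_child N h]
      exact (hN T x hx).trans
        (Finset.sum_le_sum fun i _ => ih (hC.child h i) (child_arg_nonneg _ i hx))

theorem strictMono_neckLevel {T : VTree D V} (h : {n | T.IsNeckLevel n}.Infinite) :
    StrictMono T.neckLevel := by
  refine strictMono_nat_of_lt_succ fun l => ?_
  cases l with
  | zero =>
    obtain ⟨n, hn, -⟩ := Nat.nth_mem_of_infinite h 0
    exact (Nat.succ_pos n).trans_eq hn.symm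
  | succ l => exact Nat.nth_strictMono h l.lt_succ_self

/-- Along a word the product m r does not increase, and in generation n it is at most βⁿ. A member
of the set is thus the first neck-level ancestor at which m r drops to the threshold or below. It
exists by the L-th neck level once β^L is below the threshold, because that level is at least L. -/
theorem exists_isCut_cutSet {β : ℝ} (hβ1 : β < 1) (hβ : ∀ j i, D.r j i ≤ β) {T : VTree D V}
    (h : {n | T.IsNeckLevel n}.Infinite) (k : ℕ) : ∃ M, IsCut (T.cutSet k) M := by
  have hmono := strictMono_neckLevel h
  cases k with
  | zero =>
    refine ⟨0, ⟨fun w hw n _ => ?_, fun w _ => ⟨0, Node.take_zero w⟩⟩⟩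
    obtain rfl : w = Node.root := hw
    rfl
  | succ k =>
    set ε := Real.exp (-((k + 1 : ℕ) : ℝ)) with hε
    have hβ0 : 0 ≤ β := (D.r_pos T.index ⟨0, by have := D.two_le_N T.index; omega⟩).le.trans
      (hβ _ _)
    obtain ⟨L, hL⟩ := exists_pow_lt_of_lt_one (Real.exp_pos (-((k + 1 : ℕ) : ℝ))) hβ1
    refine ⟨T.neckLevel L, ⟨?_, fun w hw => ?_⟩⟩
    · rintro w ⟨l, hl, hlen, -, hlt⟩ n ⟨l', -, hlen', hle', -⟩
      rw [Node.length_take] at hlen'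
      rcases le_or_gt w.length n with hn | hn
      · exact Node.take_of_length_le w n hn
      · exfalso
        rw [min_eq_left hn.le] at hlen'
        -- A proper ancestor in the set would lie at an earlier neck level l' ≤ l − 1, where m r is
        -- already at most the threshold, although it still exceeds the threshold at level l − 1.
        have h1 : l' < l := hmono.lt_iff_lt.1 (by omega)
        have h2 : T.neckLevel l' ≤ T.neckLevel (l - 1) := hmono.monotone (by omega)
        have h3 := (w.take (T.neckLevel (l - 1))).mass_mul_ratio_le_take n
        rw [Node.take_take w (hlen' ▸ h2)] at h3
        linarith
    · have hwL : (w.take (T.neckLevel L)).mass * (w.take (T.neckLevel L)).ratio ≤ ε := by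
        rw [Node.take_of_length_le w _ hw.le]
        refine (w.mass_mul_ratio_le_pow hβ).trans ((pow_le_pow_of_le_one hβ0 hβ1.le ?_).trans hL.le)
        rw [hw]
        exact hmono.le_apply
      have hex : ∃ l, (w.take (T.neckLevel l)).mass * (w.take (T.neckLevel l)).ratio ≤ ε :=
        ⟨L, hwL⟩
      classical
      set l := Nat.find hex with hl
      have hl1 := Nat.find_spec hex
      rw [← hl] at hl1
      have hlL : l ≤ L := Nat.find_min' hex hwL
      have hl0 : l ≠ 0 := by
        intro h0
        rw [h0] at hl1
        change (w.take 0).mass * (w.take 0).ratio ≤ ε at hl1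
        rw [Node.take_zero] at hl1
        -- The ancestor has m r = 1, above the threshold, since the exponent is at least one; for
        -- index 0 this would fail, and there the cut is the ancestor itself.
        have : ε < 1 := Real.exp_lt_one_iff.2 (neg_lt_zero.2 (Nat.cast_pos.2 k.succ_pos))
        simp [Node.mass, Node.ratio] at hl1
        linarith
      refine ⟨T.neckLevel l, l, Nat.one_le_iff_ne_zero.2 hl0, ?_, hl1, ?_⟩
      · rw [Node.length_take, hw, min_eq_left (hmono.monotone hlL)]
      · rw [Node.take_take w (hmono.monotone (Nat.sub_le l 1))]
        exact not_le.1 (Nat.find_min hex (by omega))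

theorem sum_dirichletCount_child_le {β : ℝ} (hβ1 : β < 1) (hβ : ∀ j i, D.r j i ≤ β)
    (T : VTree D V) (x : ℝ) (hx : 0 ≤ x) :
    ∑ i, (T.child i).dirichletCount (D.r T.index i * D.m T.index i * x) ≤ T.dirichletCount x :=
  IFSFamily.sum_eigenvalueCount_sobolevZero_le
    (fun _ hf => integral_cantorMeasure hβ1 hβ T hf) hx

theorem neumannCount_le_sum_child {β : ℝ} (hβ1 : β < 1) (hβ : ∀ j i, D.r j i ≤ β)
    (T : VTree D V) (x : ℝ) (hx : 0 ≤ x) :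
    T.neumannCount x ≤ ∑ i, (T.child i).neumannCount (D.r T.index i * D.m T.index i * x) :=
  IFSFamily.eigenvalueCount_sobolev_le_sum
    (fun _ hf => integral_cantorMeasure hβ1 hβ T hf) hx

end VTree

theorem corollary4p8 {J : Type*} (D : IFSFamily J)
    (hC1 : ∃ B : ℕ, ∀ j, D.N j ≤ B)
    (hC2 : ∃ α β : ℝ, 0 < α ∧ β < 1 ∧ ∀ j i, α ≤ D.m j i ∧ D.m j i ≤ β)
    (hC3 : ∃ α β : ℝ, 0 < α ∧ β < 1 ∧ ∀ j i, α ≤ D.r j i ∧ D.r j i ≤ β)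
    {V : ℕ} (T : VTree D V) (hneck : {n | T.IsNeckLevel n}.Infinite)
    (k : ℕ) (x : ℝ) (hx : 0 ≤ x) :
    ∑' w : T.cutSet k, w.1.subtree.dirichletCount (w.1.ratio * w.1.mass * x)
        ≤ T.dirichletCount x ∧
      T.dirichletCount x ≤ T.neumannCount x ∧
      T.neumannCount x
        ≤ ∑' w : T.cutSet k, w.1.subtree.neumannCount (w.1.ratio * w.1.mass * x) := by
  obtain ⟨_, β, -, hβ1, hr⟩ := hC3
  have hβ : ∀ j i, D.r j i ≤ β := fun j i => (hr j i).2
  obtain ⟨M, hM⟩ := VTree.exists_isCut_cutSet hβ1 hβ hneck k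
  exact ⟨VTree.tsum_le_of_isCut (VTree.sum_dirichletCount_child_le hβ1 hβ) hM hx,
    D.eigenvalueCount_sobolevZero_le _ hx,
    VTree.le_tsum_of_isCut (VTree.neumannCount_le_sum_child hβ1 hβ) hM hx⟩
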